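/- Let $n\ge 2$, let $w_0,\dots,w_n$ be positive integers with $\gcd(w_0,\dots,w_n)=1$, and put $\mu=\sum_i w_i$. Fix a $\mathbb{Z}$-basis of the lattice $\{x\in\mathbb{Z}^{n+1}\mid\sum_i w_ix_i=0\}$, let $M$ be the $(n+1)\times n$ matrix whose columns are this basis and $m_0,\dots,m_n\in\mathbb{Z}^n$ its rows, so that $u_i=v^{m_i}$ parametrizes the torus $U=\{\prod_i u_i^{w_i}=1\}$ by $v\in(\mathbb{C}^*)^n$. Let $f=\sum_i w_iu_i=\sum_i w_iv^{m_i}$ on $U$, and let $$G=\Omega^n(U)[\tau,\tau^{-1}]/(d-\tau\,df\wedge)\,\Omega^{n-1}(U)[\tau,\tau^{-1}]$$ be its Gauss–Manin system; trivializing $\Omega^n(U)$ by $\frac{dv_1}{v_1}\wedge\dots\wedge\frac{dv_n}{v_n}$, this is $$G=\mathbb{C}[v,v^{-1},\tau,\tau^{-1}]\Big/\Big\{\sum_{j=1}^n\big(v_j\partial_{v_j}\varphi_j-\tau(v_j\partial_{v_j}f)\varphi_j\big)\ \Big|\ \varphi_j\in\mathbb{C}[v,v^{-1},\tau,\tau^{-1}]\Big\},$$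 with the connection $\partial_\tau[\varphi]=[\partial\varphi/\partial\tau-f\varphi]$. Put $\theta=\tau^{-1}$, and let $G_0\subset G$ be the Brieskorn lattice, i.e. the $\mathbb{C}[\theta]$-submodule generated by the classes of the Laurent monomials in $v$. Let $V_\bullet G$ be the increasing Malgrange–Kashiwara filtration at $\tau=0$, i.e. the filtration $(V_\alpha)_{\alpha\in\mathbb{Q}}$ by finitely generated $\mathbb{C}[\tau]$-submodules stable under $\tau\partial_\tau$ such that $\bigcup_\alpha V_\alpha=G$, $\tau V_\alpha=V_{\alpha-1}$, $V_\alpha=V_{\lfloor N\alpha\rfloor/N}$ for some integer $N\ge1$ and all $\alpha$, and $\tau\partial_\tau+\alpha$ is nilpotent on $V_\alpha/V_{<\alpha}$, where $V_{<\alpha}=\bigcup_{\beta<\alpha}V_\beta$; this filtration exists and is unique. Define $a(k)\in\mathbb{N}^{n+1}$ by $a(0)=0$ and $a(k+1)=a(k)+\mathbf{1}_{i(k)}$, where $i(k)$ is the smallest index $i$ for which $a(k)_i/w_i$ is minimal, and let $\omega_k\in G$ be the class of $u^{a(k)}\frac{dv_1}{v_1}\wedge\dots\wedge\frac{dv_n}{v_n}$.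 Let $\overline G$ be $G$ with the $\mathbb{C}[\tau,\tau^{-1}]$-module structure $p(\tau)\,\overline g=\overline{p(-\tau)g}$ and the connection $\partial_\tau\overline g=-\overline{\partial_\tau g}$; for $p\in\mathbb{C}[\tau,\tau^{-1}]$ put $\overline{p(\tau)}=p(-\tau)$. Consider the nondegenerate $\mathbb{C}[\tau,\tau^{-1}]$-bilinear pairings $S:G\otimes_{\mathbb{C}[\tau,\tau^{-1}]}\overline G\to\mathbb{C}[\tau,\tau^{-1}]$ such that 1. $\dfrac{d}{d\tau}S(x,\overline y)=S(\partial_\tau x,\overline y)-S(x,\overline{\partial_\tau y})$ for all $x,y\in G$; 2. $S(V_0\otimes\overline{V_{<1}})\subset\mathbb{C}[\tau]$; 3. $S(G_0\otimes\overline{G_0})\subset\theta^n\mathbb{C}[\theta]$. Such a pairing exists and is unique up to multiplication by a nonzero complex constant (and every nonzero constant multiple of such a pairing is again one). Every such $S$ satisfies, for $0\le k,\ell\le\mu-1$, $$S(\omega_k,\overline{\omega_\ell})=\begin{cases}S(\omega_0,\overline{\omega_n})&\text{if }0\le k\le n\text{ and }k+\ell=n,\text{ or if }n+1\le k\le\mu-1\text{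 and }k+\ell=\mu+n,\\0&\text{otherwise,}\end{cases}$$ each $S(\omega_k,\overline{\omega_\ell})$ belongs to $\mathbb{C}\,\tau^{-n}$, and $S(\omega_0,\overline{\omega_n})\neq0$. Moreover $S(y,\overline x)=(-1)^n\,\overline{S(x,\overline y)}$ for all $x,y\in G$. Here nondegenerate means that no nonzero element of $G$, respectively $\overline G$, is orthogonal to everything; every such $S$ is then even perfect, i.e. it induces bijections from $G$ onto $\mathrm{Hom}_{\mathbb{C}[\tau,\tau^{-1}]}(\overline G,\mathbb{C}[\tau,\tau^{-1}])$ and from $\overline G$ onto $\mathrm{Hom}_{\mathbb{C}[\tau,\tau^{-1}]}(G,\mathbb{C}[\tau,\tau^{-1}])$. -/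

import Mathlib

open scoped LaurentPolynomial

noncomputable section

namespace GaussManin

open LaurentPolynomial

/-! ### The ring `ℂ[τ, τ⁻¹]` -/

/-- The ring `ℂ[τ, τ⁻¹]`, with `τ = T 1` and `θ = τ⁻¹ = T (-1)`. -/
abbrev CTau : Type := ℂ[T;T⁻¹]

/-- The subring `ℂ[τ]` of `ℂ[τ, τ⁻¹]`. -/
def tauPoly : Subalgebra ℂ CTau := Algebra.adjoin ℂ {T 1}

/-- The subring `ℂ[θ]` of `ℂ[τ, τ⁻¹]`, where `θ = τ⁻¹`. -/
def thetaPoly : Subalgebra ℂ CTau := Algebra.adjoin ℂ {T (-1)}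

/-- The unit `-τ` of `ℂ[τ, τ⁻¹]`. -/
def negTau : CTauˣ where
  val := -T 1
  inv := -T (-1)
  val_inv := by rw [neg_mul_neg, ← T_add, add_neg_cancel, T_zero]
  inv_val := by rw [neg_mul_neg, ← T_add, neg_add_cancel, T_zero]

/-- The involution `p(τ) ↦ p(-τ)` of `ℂ[τ, τ⁻¹]`. -/
def bar : CTau →+* CTau := eval₂ C negTau

/-- The derivation `d/dτ` of `ℂ[τ, τ⁻¹]`: `∑ cₖ τᵏ ↦ ∑ k cₖ τᵏ⁻¹`. -/
def dTau : CTau →ₗ[ℂ] CTau where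
  toFun p := p.coeff.sum fun k c => AddMonoidAlgebra.single (k - 1) ((k : ℂ) * c)
  map_add' p q := by
    rw [AddMonoidAlgebra.coeff_add, Finsupp.sum_add_index'] <;>
      simp [mul_add, AddMonoidAlgebra.single_add]
  map_smul' r p := by
    rw [AddMonoidAlgebra.coeff_smul, Finsupp.sum_smul_index (by simp), Finsupp.smul_sum]
    refine Finsupp.sum_congr fun k _ => ?_
    rw [RingHom.id_apply, AddMonoidAlgebra.smul_single, smul_eq_mul, mul_left_comm]

/-! ### The Gauss-Manin system of a Laurent polynomial in `n` variables -/

variable {n : ℕ}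

/-- The ring `ℂ[v, v⁻¹]`, `v = (v₁, …, vₙ)`, of functions on the torus `(ℂ*)ⁿ`;
the monomial `vᵃ` is `single a 1`. -/
abbrev TorusRing (n : ℕ) : Type := AddMonoidAlgebra ℂ (Fin n → ℤ)

/-- The ring `ℂ[v, v⁻¹, τ, τ⁻¹]`. -/
abbrev TorusRingTau (n : ℕ) : Type := AddMonoidAlgebra CTau (Fin n → ℤ)

/-- The inclusion `ℂ[v, v⁻¹] → ℂ[v, v⁻¹, τ, τ⁻¹]`. -/
def incl (n : ℕ) : TorusRing n →+* TorusRingTau n :=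
  AddMonoidAlgebra.mapRingHom _ C

/-- The operator `vⱼ ∂/∂vⱼ` on `ℂ[v, v⁻¹, τ, τ⁻¹]`: `∑ cₐ vᵃ ↦ ∑ aⱼ cₐ vᵃ`. -/
def vdv (j : Fin n) : TorusRingTau n →ₗ[CTau] TorusRingTau n where
  toFun φ := φ.coeff.sum fun a c => AddMonoidAlgebra.single a ((a j : CTau) * c)
  map_add' p q := by
    rw [AddMonoidAlgebra.coeff_add, Finsupp.sum_add_index'] <;>
      simp [mul_add, AddMonoidAlgebra.single_add]
  map_smul' r p := by
    rw [AddMonoidAlgebra.coeff_smul, Finsupp.sum_smul_index (by simp), Finsupp.smul_sum]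
    simp [mul_left_comm]

/-- The operator `∂/∂τ` on `ℂ[v, v⁻¹, τ, τ⁻¹]`, acting on the coefficients. -/
def coeffDTau (n : ℕ) : TorusRingTau n →ₗ[ℂ] TorusRingTau n where
  toFun φ := φ.coeff.sum fun a c => AddMonoidAlgebra.single a (dTau c)
  map_add' p q := by
    rw [AddMonoidAlgebra.coeff_add, Finsupp.sum_add_index'] <;>
      simp [AddMonoidAlgebra.single_add]
  map_smul' r p := by
    rw [AddMonoidAlgebra.coeff_smul, Finsupp.sum_smul_index' (by simp), Finsupp.smul_sum]
    simp

/-- With the trivialisation of the `n`-forms on the torus by `dv₁/v₁ ∧ ⋯ ∧ dvₙ/vₙ`, and the one of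
the `(n-1)`-forms by its contractions with the fields `vⱼ ∂/∂vⱼ`, this is the image of
`d - τ df ∧` in the `n`-forms: all sums of `vⱼ ∂φⱼ/∂vⱼ - τ (vⱼ ∂f/∂vⱼ) φⱼ`. -/
def relations (f : TorusRing n) : Submodule CTau (TorusRingTau n) :=
  Submodule.span CTau
    {x | ∃ (j : Fin n) (φ : TorusRingTau n),
      x = vdv j φ - (T 1 : CTau) • (vdv j (incl n f) * φ)}

/-- The Gauss-Manin system `G = Ωⁿ[τ, τ⁻¹] / (d - τ df ∧) Ωⁿ⁻¹[τ, τ⁻¹]` of a Laurent polynomial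
`f` on the torus `(ℂ*)ⁿ`. -/
abbrev System (f : TorusRing n) : Type := TorusRingTau n ⧸ relations f

/-- The class in `G` of `vᵃ dv₁/v₁ ∧ ⋯ ∧ dvₙ/vₙ`. -/
def monomialClass (f : TorusRing n) (a : Fin n → ℤ) : System f :=
  (relations f).mkQ (AddMonoidAlgebra.single a 1)

/-- The Brieskorn lattice `G₀`, the image of `Ωⁿ[θ]` in `G`, as a `ℂ[θ]`-submodule. -/
def brieskorn (f : TorusRing n) : Submodule thetaPoly (System f) :=
  Submodule.span thetaPoly (Set.range (monomialClass f))

lemma dTau_single (k : ℤ) (c : ℂ) :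
    dTau (AddMonoidAlgebra.single k c) = AddMonoidAlgebra.single (k - 1) ((k : ℂ) * c) := by
  change (AddMonoidAlgebra.single k c).coeff.sum
    (fun k c => AddMonoidAlgebra.single (k - 1) ((k : ℂ) * c)) = _
  exact Finsupp.sum_single_index (by simp)

lemma dTau_mul (p q : CTau) : dTau (p * q) = dTau p * q + p * dTau q := by
  induction p using AddMonoidAlgebra.induction_linear with
  | zero => simp
  | add p p' h h' => rw [add_mul, map_add, h, h', map_add]; ring
  | single k c =>
    induction q using AddMonoidAlgebra.induction_linear with
    | zero => simp
    | add p p' h h' => rw [mul_add, map_add, h, h', map_add]; ring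
    | single l d =>
      simp only [AddMonoidAlgebra.single_mul_single, dTau_single]
      rw [show k - 1 + l = k + l - 1 by ring, show k + (l - 1) = k + l - 1 by ring,
        ← AddMonoidAlgebra.single_add]
      congr 1
      push_cast
      ring

lemma vdv_single (j : Fin n) (a : Fin n → ℤ) (c : CTau) :
    vdv j (AddMonoidAlgebra.single a c) = AddMonoidAlgebra.single a ((a j : CTau) * c) := by
  change (AddMonoidAlgebra.single a c).coeff.sum
    (fun a c => AddMonoidAlgebra.single a ((a j : CTau) * c)) = _
  exact Finsupp.sum_single_index (by simp)

lemma coeffDTau_single (a : Fin n → ℤ) (c : CTau) :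
    coeffDTau n (AddMonoidAlgebra.single a c) = AddMonoidAlgebra.single a (dTau c) := by
  change (AddMonoidAlgebra.single a c).coeff.sum
    (fun a c => AddMonoidAlgebra.single a (dTau c)) = _
  exact Finsupp.sum_single_index (by simp)

lemma vdv_mul (j : Fin n) (p q : TorusRingTau n) : vdv j (p * q) = vdv j p * q + p * vdv j q := by
  induction p using AddMonoidAlgebra.induction_linear with
  | zero => simp
  | add p p' h h' => rw [add_mul, map_add, h, h', map_add]; ring
  | single k c =>
    induction q using AddMonoidAlgebra.induction_linear with
    | zero => simp
    | add p p' h h' => rw [mul_add, map_add, h, h', map_add]; ring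
    | single l d =>
      simp only [AddMonoidAlgebra.single_mul_single, vdv_single]
      rw [← AddMonoidAlgebra.single_add]
      congr 1
      simp only [Pi.add_apply]
      push_cast
      ring

lemma coeffDTau_mul (p q : TorusRingTau n) :
    coeffDTau n (p * q) = coeffDTau n p * q + p * coeffDTau n q := by
  induction p using AddMonoidAlgebra.induction_linear with
  | zero => simp
  | add p p' h h' => rw [add_mul, map_add, h, h', map_add]; ring
  | single k c =>
    induction q using AddMonoidAlgebra.induction_linear with
    | zero => simp
    | add p p' h h' => rw [mul_add, map_add, h, h', map_add]; ring
    | single l d =>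
      simp only [AddMonoidAlgebra.single_mul_single, coeffDTau_single, dTau_mul,
        AddMonoidAlgebra.single_add]

lemma coeffDTau_smul (p : CTau) (φ : TorusRingTau n) :
    coeffDTau n (p • φ) = dTau p • φ + p • coeffDTau n φ := by
  induction φ using AddMonoidAlgebra.induction_linear with
  | zero => simp
  | add p p' h h' => rw [smul_add, map_add, h, h', map_add, smul_add, smul_add]; abel
  | single a c =>
    simp only [AddMonoidAlgebra.smul_single, smul_eq_mul, coeffDTau_single, dTau_mul,
      AddMonoidAlgebra.single_add]

lemma dTau_intCast (k : ℤ) : dTau (k : CTau) = 0 := by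
  have h : (k : CTau) = AddMonoidAlgebra.single 0 (k : ℂ) := (map_intCast (C : ℂ →+* CTau) k).symm
  rw [h, dTau_single]; simp

lemma coeffDTau_vdv (j : Fin n) (φ : TorusRingTau n) :
    coeffDTau n (vdv j φ) = vdv j (coeffDTau n φ) := by
  induction φ using AddMonoidAlgebra.induction_linear with
  | zero => simp
  | add p p' h h' => simp only [map_add, h, h']
  | single a c =>
    simp only [coeffDTau_single, vdv_single, dTau_mul, dTau_intCast, zero_mul, zero_add]

lemma coeffDTau_incl (f : TorusRing n) : coeffDTau n (incl n f) = 0 := by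
  induction f using AddMonoidAlgebra.induction_linear with
  | zero => simp
  | add p p' h h' => simp only [map_add, h, h', add_zero]
  | single a c =>
    have h : incl n (AddMonoidAlgebra.single a c) = AddMonoidAlgebra.single a (C c) :=
      AddMonoidAlgebra.mapRingHom_single ..
    have h' : dTau (C c) = 0 := by
      rw [show (C c : CTau) = AddMonoidAlgebra.single 0 c from rfl, dTau_single]; simp
    rw [h, coeffDTau_single, h', AddMonoidAlgebra.single_zero]

lemma dTau_T_one : dTau (T 1) = 1 := by
  rw [show (T 1 : CTau) = AddMonoidAlgebra.single 1 1 from rfl, dTau_single]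
  rw [Int.cast_one, mul_one, sub_self]
  rfl

/-- The operator `∂/∂τ - f` on `ℂ[v, v⁻¹, τ, τ⁻¹]`. -/
def preConnection (f : TorusRing n) : TorusRingTau n →ₗ[ℂ] TorusRingTau n :=
  coeffDTau n - LinearMap.mulLeft ℂ (incl n f)

lemma preConnection_relation (f : TorusRing n) (j : Fin n) (φ : TorusRingTau n) :
    preConnection f (vdv j φ - (T 1 : CTau) • (vdv j (incl n f) * φ)) =
      vdv j (preConnection f φ) -
        (T 1 : CTau) • (vdv j (incl n f) * preConnection f φ) := by
  have h : ∀ ψ, preConnection f ψ = coeffDTau n ψ - incl n f * ψ := fun _ => rfl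
  rw [h, h, map_sub, map_sub, vdv_mul, coeffDTau_smul, coeffDTau_mul, coeffDTau_vdv,
    coeffDTau_vdv, coeffDTau_incl, map_zero, dTau_T_one, one_smul, zero_mul, zero_add]
  rw [Algebra.smul_def, Algebra.smul_def, Algebra.smul_def]
  ring

lemma preConnection_mem (f : TorusRing n) :
    (relations f).restrictScalars ℂ ≤
      ((relations f).restrictScalars ℂ).comap (preConnection f) := by
  intro x hx
  change preConnection f x ∈ relations f
  replace hx : x ∈ relations f := hx
  induction hx using Submodule.span_induction with
  | mem x h =>
    obtain ⟨j, φ, rfl⟩ := h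
    rw [preConnection_relation]
    exact Submodule.subset_span ⟨j, _, rfl⟩
  | zero => simp
  | add x y _ _ hx hy => rw [map_add]; exact add_mem hx hy
  | smul p x hx h =>
    have e : preConnection f (p • x) = dTau p • x + p • preConnection f x := by
      simp only [preConnection, LinearMap.sub_apply, LinearMap.mulLeft_apply, coeffDTau_smul,
        smul_sub, mul_smul_comm]
      abel
    rw [e]
    exact add_mem (Submodule.smul_mem _ _ hx) (Submodule.smul_mem _ _ h)

/-- The action of `∂_τ` on `G`: the class of `φ` goes to the class of `∂φ/∂τ - f φ`. -/
def connection (f : TorusRing n) : System f →ₗ[ℂ] System f :=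
  (Submodule.Quotient.restrictScalarsEquiv ℂ (relations f)).toLinearMap ∘ₗ
    ((relations f).restrictScalars ℂ).mapQ _ (preConnection f) (preConnection_mem f) ∘ₗ
      (Submodule.Quotient.restrictScalarsEquiv ℂ (relations f)).symm.toLinearMap

lemma connection_mk (f : TorusRing n) (φ : TorusRingTau n) :
    connection f ((relations f).mkQ φ) =
      (relations f).mkQ (coeffDTau n φ - incl n f * φ) := rfl

/-! ### The Malgrange-Kashiwara filtration at `τ = 0` -/

section VFiltration

variable {M : Type*} [AddCommGroup M] [Module CTau M]

/-- `V_{<α} = ⋃_{β < α} V_β`. -/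
def below (V : ℚ → Submodule tauPoly M) (α : ℚ) : Submodule tauPoly M :=
  ⨆ β : {β : ℚ // β < α}, V β

/-- The operator `τ ∂_τ + α` on a module with connection `D = ∂_τ`. -/
def eulerShift (D : M → M) (α : ℚ) (x : M) : M :=
  (T 1 : CTau) • D x + (C (α : ℂ) : CTau) • x

/-- The properties which characterise the (increasing, rationally indexed) Malgrange-Kashiwara
filtration along `τ = 0` of a `ℂ[τ, τ⁻¹]`-module `M` with connection `D = ∂_τ`, regular singular
with rational exponents at `τ = 0`: the `V_α` are finitely generated `ℂ[τ]`-submodules stable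
under `τ ∂_τ`, they exhaust `M`, the index set can be reduced to `(1/N) ℤ` for some `N ≥ 1`, one
has `τ V_α = V_{α-1}`, and `τ ∂_τ + α` is nilpotent on `V_α / V_{<α}`. -/
structure IsVFiltration (D : M → M) (V : ℚ → Submodule tauPoly M) : Prop where
  mono : Monotone V
  exhaustive : ∀ x, ∃ α, x ∈ V α
  discrete : ∃ N : ℕ, 0 < N ∧ ∀ α : ℚ, V α = V ((⌊(N : ℚ) * α⌋ : ℚ) / N)
  fg : ∀ α, (V α).FG
  shift : ∀ α x, x ∈ V α ↔ (T 1 : CTau) • x ∈ V (α - 1)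
  stable : ∀ α, ∀ x ∈ V α, (T 1 : CTau) • D x ∈ V α
  nilpotent : ∀ α, ∃ m : ℕ, ∀ x ∈ V α, (eulerShift D α)^[m] x ∈ below V α

end VFiltration

/-! ### The Laurent polynomial attached to the weights -/

/-- The lattice of the `x ∈ ℤⁿ⁺¹` such that `∑ wᵢ xᵢ = 0`. -/
def weightLattice (w : Fin (n + 1) → ℕ) : Submodule ℤ (Fin (n + 1) → ℤ) :=
  LinearMap.ker (∑ i, (w i : ℤ) • (LinearMap.proj i : (Fin (n + 1) → ℤ) →ₗ[ℤ] ℤ))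

/-- The vector `mᵢ ∈ ℤⁿ`, the `i`-th row of the matrix whose columns form the basis `b`. -/
def row {w : Fin (n + 1) → ℕ} (b : Module.Basis (Fin n) ℤ (weightLattice w)) (i : Fin (n + 1)) :
    Fin n → ℤ :=
  fun j => (b j : Fin (n + 1) → ℤ) i

/-- The Laurent polynomial `f = ∑ wᵢ uᵢ` on the torus `∏ uᵢ^wᵢ = 1`, in the coordinates `v` given
by the parametrisation `uᵢ = v^mᵢ`. -/
def weightPoly {w : Fin (n + 1) → ℕ} (b : Module.Basis (Fin n) ℤ (weightLattice w)) :
    TorusRing n :=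
  ∑ i, AddMonoidAlgebra.single (row b i) (w i : ℂ)

lemma exists_isLeast_ratio (w a : Fin (n + 1) → ℕ) :
    (Finset.univ.filter fun i : Fin (n + 1) =>
      ∀ j, (a i : ℚ) / w i ≤ (a j : ℚ) / w j).Nonempty := by
  obtain ⟨i, -, hi⟩ := Finset.exists_min_image Finset.univ (fun i => (a i : ℚ) / w i)
    Finset.univ_nonempty
  exact ⟨i, by simpa using hi⟩

/-- The smallest index `i` for which `aᵢ / wᵢ` is minimal. -/
def minIndex (w a : Fin (n + 1) → ℕ) : Fin (n + 1) :=
  (Finset.univ.filter fun i : Fin (n + 1) =>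
    ∀ j, (a i : ℚ) / w i ≤ (a j : ℚ) / w j).min' (exists_isLeast_ratio w a)

/-- The sequence `a(k)`: `a(0) = 0` and `a(k+1) = a(k) + 1_{i(k)}`, where `i(k)` is the smallest
index `i` for which `a(k)ᵢ / wᵢ` is minimal. -/
def exponent (w : Fin (n + 1) → ℕ) : ℕ → Fin (n + 1) → ℕ
  | 0 => 0
  | k + 1 => exponent w k + Pi.single (minIndex w (exponent w k)) 1

/-- The class `ω_k` of `u^{a(k)} dv₁/v₁ ∧ ⋯ ∧ dvₙ/vₙ` in `G`. -/
def omega {w : Fin (n + 1) → ℕ} (b : Module.Basis (Fin n) ℤ (weightLattice w)) (k : ℕ) :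
    System (weightPoly b) :=
  monomialClass (weightPoly b) (∑ i, (exponent w k i : ℤ) • row b i)

/-! ### Pairings -/

/-- A `ℂ[τ, τ⁻¹]`-bilinear pairing `G ⊗ Ḡ → ℂ[τ, τ⁻¹]`, where `Ḡ` is the group `G` on which `p(τ)`
acts as `p(-τ)`: the value `S x y` stands for `S(x, ȳ)`, so `S` is linear in `x` and semilinear
in `y` with respect to `τ ↦ -τ`. -/
abbrev Pairing (f : TorusRing n) : Type := System f →ₗ[CTau] System f →ₛₗ[bar] CTau

/-- A nondegenerate pairing `S` which is horizontal, sends `V₀ ⊗ V̄_{<1}` into `ℂ[τ]` and sends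
`G₀ ⊗ Ḡ₀` into `θⁿ ℂ[θ]`; here `∂_τ ȳ` is the element of `Ḡ` given by `-∂_τ y`. -/
structure IsDuality (f : TorusRing n) (V : ℚ → Submodule tauPoly (System f)) (S : Pairing f) :
    Prop where
  nondegenerate : S.Nondegenerate
  horizontal : ∀ x y, dTau (S x y) = S (connection f x) y - S x (connection f y)
  map_V : ∀ x ∈ V 0, ∀ y ∈ below V 1, S x y ∈ tauPoly
  map_brieskorn : ∀ x ∈ brieskorn f, ∀ y ∈ brieskorn f, ∃ p ∈ thetaPoly, S x y = T (-(n : ℤ)) * p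

end GaussManin

end

open GaussManin

open scoped LaurentPolynomial

noncomputable section

namespace GaussManin

open LaurentPolynomial

variable {n : ℕ}

/-! ### The sequence of exponents -/

section Exponent

/-! Everything is computed in one explicit basis. Write α(k) = k - μ minᵢ a(k)ᵢ/wᵢ. The relations of
`G` give (`uMonomial_add_single`) -μτ u^(x+1ᵢ) = (τ∂_τ + |x| - μxᵢ/wᵢ) uˣ, and along the sequence
a(k) this reads τ∂_τ ω_k = -α(k) ω_k - μτ ω_{k+1}. Since u^w = 1 and a(k+μ) = a(k) + w, the index k
lives modulo μ. The recursion shows that the ω_k generate `G`, and even contain the Brieskorn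
lattice in their ℂ[θ]-span. They are independent because the same recursion, run in a free module of
rank μ with the expected connection, is compatible with all the relations, so that it defines a map
from `G` sending ω_k to the k-th basis vector (`toModel`).

The numbers α(k) satisfy four facts: α(k+1) ≤ α(k) + 1; α ≥ 0; α(k) + α(l) = n when k + l ≡ n mod μ;
and α(k) = 0 only when μ divides k. They all come from the description of the minimal ratio by sums
of floors and ceilings (`level_eq`) and from gcd(w) = 1.

By the first two facts, giving τʲω_k the order α(k) - j defines a Malgrange-Kashiwara filtration
(`isVFiltration_orderFiltration`). It is the only one, since generalised eigenspaces for different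
eigenvalues cannot mix (`le_of_nilpotent`).

For the pairing, horizontality is a recursion on the coefficients of the S(ω_k, ω_l). With the pole
condition it leaves only the values for k + l ≡ n, all equal to one multiple of τ⁻ⁿ
(`coefficients_eq_of_recursion`). Conversely the pairing with these values (`basisPairing`) has all
the required properties, and its symmetry and perfectness are visible on the basis. `isDuality_iff`
collects this. -/

lemma exists_sum_mul_eq_one {ι : Type*} [Fintype ι] {w : ι → ℕ} (hgcd : Finset.univ.gcd w = 1) :
    ∃ p : ι → ℤ, ∑ i, p i * w i = 1 := by
  obtain ⟨g, hg⟩ := Finset.gcd_eq_sum_mul Finset.univ fun i => (w i : ℤ)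
  have h : Finset.univ.gcd (fun i => (w i : ℤ)) ∣ 1 := by
    rw [← Int.natAbs_dvd_natAbs, Int.natAbs_one, ← hgcd]
    refine Finset.dvd_gcd fun i hi => ?_
    have := Finset.gcd_dvd (f := fun i => (w i : ℤ)) hi
    rwa [← Int.natAbs_dvd_natAbs, Int.natAbs_natCast] at this
  obtain ⟨c, hc⟩ := h
  refine ⟨fun i => c * g i, ?_⟩
  rw [hc, hg, Finset.sum_mul]
  exact Finset.sum_congr rfl fun i _ => by ring

variable (w : Fin (n + 1) → ℕ)

lemma minIndex_le (a : Fin (n + 1) → ℕ) (j : Fin (n + 1)) :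
    (a (minIndex w a) : ℚ) / w (minIndex w a) ≤ (a j : ℚ) / w j := by
  have h := Finset.min'_mem _ (exists_isLeast_ratio w a)
  rw [Finset.mem_filter] at h
  exact h.2 j

/-- The smallest of the ratios `a(k)ᵢ / wᵢ`. -/
def level (k : ℕ) : ℚ :=
  (exponent w k (minIndex w (exponent w k)) : ℚ) / w (minIndex w (exponent w k))

/-- The rational number `α(k) = k - μ minᵢ a(k)ᵢ / wᵢ`. -/
def spectralNumber (k : ℕ) : ℚ := k - (∑ i, w i : ℕ) * level w k

lemma exponent_succ (k : ℕ) :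
    exponent w (k + 1) = exponent w k + Pi.single (minIndex w (exponent w k)) 1 := rfl

lemma sum_exponent (k : ℕ) : ∑ i, exponent w k i = k := by
  induction k with
  | zero => simp [exponent]
  | succ k ih => simp [exponent_succ, Finset.sum_add_distrib, ih]

variable {w} (hw : ∀ i, 0 < w i)
include hw

lemma level_mul_le (k : ℕ) (i : Fin (n + 1)) : level w k * w i ≤ exponent w k i := by
  have h : (0 : ℚ) < w i := by exact_mod_cast hw i
  rw [← le_div_iff₀ h]
  exact minIndex_le w _ i

lemma level_mul_minIndex (k : ℕ) :
    level w k * w (minIndex w (exponent w k)) = exponent w k (minIndex w (exponent w k)) := by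
  have h : (0 : ℚ) < w (minIndex w (exponent w k)) := by exact_mod_cast hw _
  rw [level, div_mul_cancel₀ _ h.ne']

omit hw in
lemma level_nonneg (k : ℕ) : 0 ≤ level w k := by
  unfold level; positivity

lemma level_le_of_le_exponent {k : ℕ} {a : Fin (n + 1) → ℕ} (h : exponent w k ≤ a)
    (j : Fin (n + 1)) : level w k ≤ (a j : ℚ) / w j := by
  have h0 : (0 : ℚ) < w j := by exact_mod_cast hw j
  rw [le_div_iff₀ h0]
  refine (level_mul_le hw k j).trans ?_
  exact_mod_cast h j

lemma level_mono : Monotone (level w) := by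
  refine monotone_nat_of_le_succ fun k => ?_
  refine level_le_of_le_exponent hw (k := k) ?_ _
  rw [exponent_succ]
  exact le_self_add

/-- An entry is raised only when its ratio is the current minimum, and that minimum never decreases
afterwards. -/
lemma exponent_le (k : ℕ) (i : Fin (n + 1)) : (exponent w k i : ℚ) ≤ level w k * w i + 1 := by
  induction k with
  | zero =>
    have := level_nonneg (w := w) 0
    simp only [exponent, Pi.zero_apply, Nat.cast_zero]
    positivity
  | succ k ih =>
    have h1 := level_mono hw (Nat.le_succ k)
    have h2 : level w k * w i ≤ level w (k + 1) * w i :=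
      mul_le_mul_of_nonneg_right h1 (Nat.cast_nonneg _)
    rw [exponent_succ, Pi.add_apply]
    by_cases hi : i = minIndex w (exponent w k)
    · rw [← hi, Pi.single_eq_same]
      have h3 := level_mul_minIndex hw k
      rw [← hi] at h3
      push_cast
      linarith
    · rw [Pi.single_eq_of_ne hi]
      push_cast
      linarith

lemma sum_ceil_level_le (k : ℕ) : ∑ i, ⌈level w k * w i⌉ ≤ k := by
  have h : (k : ℤ) = ∑ i, (exponent w k i : ℤ) := by
    rw [← Nat.cast_sum, sum_exponent]
  rw [h]
  refine Finset.sum_le_sum fun i _ => Int.ceil_le.2 ?_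
  exact_mod_cast level_mul_le hw k i

lemma lt_sum_floor_level (k : ℕ) : (k : ℤ) < ∑ i, (⌊level w k * w i⌋ + 1) := by
  have h : (k : ℤ) = ∑ i, (exponent w k i : ℤ) := by
    rw [← Nat.cast_sum, sum_exponent]
  rw [h]
  refine Finset.sum_lt_sum (fun i _ => ?_) ⟨minIndex w (exponent w k), Finset.mem_univ _, ?_⟩
  · rw [← sub_le_iff_le_add, Int.le_floor]
    have := exponent_le hw k i
    push_cast
    linarith
  -- At the minimising index the level times the weight is the integer entry itself, so the extra
  -- `1` makes the inequality strict.
  · rw [level_mul_minIndex hw]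
    simp

lemma sum_floor_le_sum_ceil {s t : ℚ} (h : s < t) :
    ∑ i, (⌊s * w i⌋ + 1) ≤ ∑ i, ⌈t * w i⌉ := by
  refine Finset.sum_le_sum fun i _ => ?_
  have h0 : (0 : ℚ) < w i := by exact_mod_cast hw i
  have h1 : s * w i < t * w i := mul_lt_mul_of_pos_right h h0
  rw [Int.add_one_le_iff, Int.lt_ceil]
  exact (Int.floor_le _).trans_lt h1

/-- By `sum_floor_le_sum_ceil` the half-open intervals [∑⌈t wᵢ⌉, ∑(⌊t wᵢ⌋ + 1)) are disjoint for
different `t`, and `k` lies in the one of its own level. The symmetries of the level can thus be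
proved without following the sequence a(k). -/
lemma level_eq {k : ℕ} {t : ℚ} (h1 : ∑ i, ⌈t * w i⌉ ≤ k) (h2 : (k : ℤ) < ∑ i, (⌊t * w i⌋ + 1)) :
    level w k = t := by
  rcases lt_trichotomy (level w k) t with h | h | h
  · have := sum_floor_le_sum_ceil hw h
    have := lt_sum_floor_level hw k
    lia
  · exact h
  · have := sum_floor_le_sum_ceil hw h
    have := sum_ceil_level_le hw k
    lia

lemma level_add_sum (k : ℕ) : level w (k + ∑ i, w i) = level w k + 1 := by
  have h1 := sum_ceil_level_le hw k
  have h2 := lt_sum_floor_level hw k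
  rw [Finset.sum_add_distrib] at h2
  apply level_eq hw
  · simp only [add_mul, one_mul, Int.ceil_add_natCast, Finset.sum_add_distrib]
    push_cast
    lia
  · simp only [add_mul, one_mul, Int.floor_add_natCast, Finset.sum_add_distrib]
    push_cast
    lia

/-- Replacing t by 1 - t exchanges floors and ceilings of t wᵢ, hence the two bounds of `level_eq`.
The shift by `n` is the number n + 1 of terms, less one for the strict inequality. -/
lemma level_reflect {k l : ℕ} (h : k + l = ∑ i, w i + n) : level w l = 1 - level w k := by
  have h1 := sum_ceil_level_le hw k
  have h2 := lt_sum_floor_level hw k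
  have h3 : (k : ℤ) + l = ∑ i, (w i : ℤ) + n := by exact_mod_cast h
  have e1 (i) : ⌈(1 - level w k) * w i⌉ = w i - ⌊level w k * w i⌋ := by
    rw [sub_mul, one_mul, sub_eq_add_neg, add_comm, Int.ceil_add_natCast, Int.ceil_neg]; ring
  have e2 (i) : ⌊(1 - level w k) * w i⌋ = w i - ⌈level w k * w i⌉ := by
    rw [sub_mul, one_mul, sub_eq_add_neg, add_comm, Int.floor_add_natCast, Int.floor_neg]; ring
  simp only [Finset.sum_add_distrib, Finset.sum_const, Finset.card_univ, Fintype.card_fin,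
    nsmul_eq_mul, mul_one, Nat.cast_add, Nat.cast_one] at h2
  apply level_eq hw
  · simp only [e1, Finset.sum_sub_distrib]
    lia
  · simp only [e2, Finset.sum_add_distrib, Finset.sum_sub_distrib, Finset.sum_const,
      Finset.card_univ, Fintype.card_fin, nsmul_eq_mul, mul_one, Nat.cast_add, Nat.cast_one]
    lia

omit hw in
lemma level_zero : level w 0 = 0 := by simp [level, exponent]

lemma exponent_sum : exponent w (∑ i, w i) = w := by
  have h (i) : w i ≤ exponent w (∑ i, w i) i := by
    have h1 := level_mul_le hw (∑ i, w i) i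
    have h2 := level_add_sum hw 0
    rw [zero_add, level_zero, zero_add] at h2
    rw [h2, one_mul] at h1
    exact_mod_cast h1
  have h3 := (Finset.sum_eq_sum_iff_of_le fun i _ => h i).1 (sum_exponent w (∑ i, w i)).symm
  exact funext fun i => (h3 i (Finset.mem_univ i)).symm

lemma minIndex_add (a : Fin (n + 1) → ℕ) : minIndex w (a + w) = minIndex w a := by
  have e (i j : Fin (n + 1)) : (((a + w) i : ℕ) : ℚ) / w i ≤ ((a + w) j : ℕ) / w j ↔
      (a i : ℚ) / w i ≤ (a j : ℚ) / w j := by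
    have h (i) : (((a + w) i : ℕ) : ℚ) / w i = (a i : ℚ) / w i + 1 := by
      have h0 : (0 : ℚ) < w i := by exact_mod_cast hw i
      rw [Pi.add_apply, Nat.cast_add, add_div, div_self h0.ne']
    rw [h, h, add_le_add_iff_right]
  simp only [minIndex, e]

lemma exponent_add_sum (k : ℕ) : exponent w (k + ∑ i, w i) = exponent w k + w := by
  induction k with
  | zero => rw [zero_add, exponent_sum hw]; simp [exponent]
  | succ k ih => rw [add_right_comm, exponent_succ, exponent_succ, ih, minIndex_add hw,
      add_right_comm]

lemma spectralNumber_add_sum (k : ℕ) :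
    spectralNumber w (k + ∑ i, w i) = spectralNumber w k := by
  simp only [spectralNumber, level_add_sum hw]
  push_cast
  ring

lemma spectralNumber_mod (k : ℕ) :
    spectralNumber w (k % ∑ i, w i) = spectralNumber w k :=
  (Function.Periodic.map_mod_nat (fun k => spectralNumber_add_sum hw k) k)

lemma spectralNumber_reflect {k l : ℕ} (h : k + l = ∑ i, w i + n) :
    spectralNumber w k + spectralNumber w l = n := by
  have h3 : (k : ℚ) + l = (∑ i, w i : ℕ) + n := by exact_mod_cast h
  simp only [spectralNumber, level_reflect hw h]
  linear_combination h3

lemma spectralNumber_succ_le (k : ℕ) : spectralNumber w (k + 1) ≤ spectralNumber w k + 1 := by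
  have h := mul_le_mul_of_nonneg_left (level_mono hw (Nat.le_succ k))
    (Nat.cast_nonneg (α := ℚ) (∑ i, w i))
  simp only [spectralNumber, Nat.succ_eq_add_one] at *
  push_cast at *
  linarith

lemma spectralNumber_nonneg (k : ℕ) : 0 ≤ spectralNumber w k := by
  have h := Finset.sum_le_sum fun i (_ : i ∈ Finset.univ) => level_mul_le hw k i
  rw [← Finset.mul_sum, ← Nat.cast_sum, ← Nat.cast_sum, sum_exponent] at h
  rw [spectralNumber]
  linarith

omit hw in
lemma spectralNumber_zero : spectralNumber w 0 = 0 := by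
  simp [spectralNumber, level_zero]

/-- Vanishing forces all the ratios a(k)ᵢ/wᵢ to be equal to the level. A Bézout relation for the
weights then makes the level an integer, and k is μ times it. -/
lemma dvd_of_spectralNumber_eq_zero (hgcd : Finset.univ.gcd w = 1) {k : ℕ}
    (h : spectralNumber w k = 0) : (∑ i, w i) ∣ k := by
  have h1 := fun i (_ : i ∈ Finset.univ) => level_mul_le hw k i
  have h2 : ∑ i, level w k * w i = ∑ i, (exponent w k i : ℚ) := by
    rw [← Finset.mul_sum, ← Nat.cast_sum, ← Nat.cast_sum, sum_exponent]
    rw [spectralNumber] at h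
    linarith
  have h3 := (Finset.sum_eq_sum_iff_of_le h1).1 h2
  obtain ⟨p, hp⟩ := exists_sum_mul_eq_one hgcd
  have h4 : level w k = (∑ i, p i * exponent w k i : ℤ) := by
    push_cast
    calc level w k = level w k * (∑ i, p i * w i : ℤ) := by rw [hp]; simp
      _ = _ := by
        push_cast
        rw [Finset.mul_sum]
        refine Finset.sum_congr rfl fun i hi => ?_
        rw [← h3 i hi]; ring
  rw [spectralNumber, h4, sub_eq_zero] at h
  rw [← Int.natCast_dvd_natCast]
  exact ⟨_, by exact_mod_cast h⟩

/-- The numbers `α(k)`, indexed by `k` modulo `μ`. -/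
def alpha (w : Fin (n + 1) → ℕ) (z : ZMod (∑ i, w i)) : ℚ := spectralNumber w z.val

lemma alpha_natCast (k : ℕ) : alpha w k = spectralNumber w k := by
  rw [alpha, ZMod.val_natCast, spectralNumber_mod hw]

omit hw in
lemma alpha_zero : alpha w 0 = 0 := by
  rw [alpha, ZMod.val_zero, spectralNumber_zero]

variable [NeZero (∑ i, w i)]

lemma alpha_add_one_le (z : ZMod (∑ i, w i)) : alpha w (z + 1) ≤ alpha w z + 1 := by
  obtain ⟨k, rfl⟩ := ZMod.natCast_zmod_surjective z
  rw [← Nat.cast_add_one, alpha_natCast hw, alpha_natCast hw]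
  exact spectralNumber_succ_le hw k

lemma alpha_add_alpha {y z : ZMod (∑ i, w i)} (h : y + z = n) : alpha w y + alpha w z = n := by
  have hy := (ZMod.val_lt y).le
  have hz : z = ((∑ i, w i + n - y.val : ℕ) : ZMod (∑ i, w i)) := by
    rw [Nat.cast_sub (by lia), Nat.cast_add, ZMod.natCast_self, ← h, ZMod.natCast_zmod_val]
    ring
  rw [hz, alpha_natCast hw]
  exact spectralNumber_reflect hw (by lia)

/-- By the reflection, α(n - z) = n - α(z) ≤ 0, and only the index 0 has a spectral number that is
not positive. -/
lemma eq_of_le_alpha (hgcd : Finset.univ.gcd w = 1) {z : ZMod (∑ i, w i)} (h : n ≤ alpha w z) :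
    z = n := by
  have h1 := alpha_add_alpha hw (add_sub_cancel z (n : ZMod (∑ i, w i)))
  have h2 := spectralNumber_nonneg hw (n - z).val
  rw [alpha, alpha] at h1
  rw [alpha] at h
  have h3 := dvd_of_spectralNumber_eq_zero hw hgcd (k := (n - z).val) (by linarith)
  rw [← ZMod.natCast_eq_zero_iff, ZMod.natCast_zmod_val, sub_eq_zero] at h3
  exact h3.symm

end Exponent

/-! ### Modules with connection over `ℂ[τ, τ⁻¹]` -/

section Connection

lemma dTau_T (k : ℤ) : dTau (T k) = (k : ℂ) • T (k - 1) := by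
  rw [T, dTau_single, T, AddMonoidAlgebra.smul_single, smul_eq_mul]

lemma T_one_mul_dTau_T (k : ℤ) : T 1 * dTau (T k) = (k : ℂ) • T k := by
  rw [dTau_T, mul_smul_comm, ← T_add, add_sub_cancel]

variable {M : Type*} [AddCommGroup M] [Module CTau M] [Module ℂ M] [IsScalarTower ℂ CTau M]

/-- The Leibniz rule for an operator on a `ℂ[τ, τ⁻¹]`-module. -/
def IsConnection (D : M →ₗ[ℂ] M) : Prop := ∀ p x, D (p • x) = dTau p • x + p • D x

/-- The operator `τ ∂_τ`. -/
def euler (D : M →ₗ[ℂ] M) : M →ₗ[ℂ] M := Algebra.lsmul ℂ ℂ M (T 1 : CTau) ∘ₗ D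

lemma euler_apply (D : M →ₗ[ℂ] M) (x : M) : euler D x = (T 1 : CTau) • D x := rfl

lemma C_smul (c : ℂ) (x : M) : (C c : CTau) • x = c • x := by
  rw [C_eq_algebraMap, algebraMap_smul]

omit [Module ℂ M] [IsScalarTower ℂ CTau M] in
lemma T_smul_T_smul (k l : ℤ) (x : M) :
    (T k : CTau) • (T l : CTau) • x = (T (k + l) : CTau) • x := by
  rw [T_add, mul_smul]

lemma smul_comm_complex (p : CTau) (c : ℂ) (x : M) : p • c • x = c • p • x := by
  rw [← C_smul, ← C_smul, smul_comm]

variable {D : M →ₗ[ℂ] M} (hD : IsConnection D)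
include hD

lemma euler_smul (p : CTau) (x : M) : euler D (p • x) = (T 1 * dTau p) • x + p • euler D x := by
  rw [euler_apply, hD, smul_add, euler_apply, mul_smul, smul_comm p]

lemma euler_T_smul (k : ℤ) (x : M) :
    euler D ((T k : CTau) • x) = (T k : CTau) • (euler D x + (k : ℂ) • x) := by
  rw [euler_smul hD, T_one_mul_dTau_T, smul_add, smul_assoc, add_comm, smul_comm_complex]

variable (D) in
/-- The element `(-μ τ)^{-|x|} ∏ᵢ ∏_{j < xᵢ} (τ ∂_τ - μ j / wᵢ) v`, where `μ = ∑ᵢ wᵢ`. -/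
def hypergeometricTerm (w : Fin (n + 1) → ℕ) (v : M) (x : Fin (n + 1) → ℕ) : M :=
  ((-(∑ i, w i : ℕ) : ℂ)⁻¹ ^ (∑ i, x i)) • (T (-(∑ i, x i : ℕ)) : CTau) •
    Polynomial.aeval (euler D) (∏ i, ∏ j ∈ Finset.range (x i),
      (Polynomial.X - Polynomial.C (((∑ i, w i : ℕ) : ℂ) * j / w i))) v

omit hD in
lemma hypergeometricTerm_zero (w : Fin (n + 1) → ℕ) (v : M) :
    hypergeometricTerm D w v 0 = v := by
  simp [hypergeometricTerm]

/-- Moving τ∂_τ past τ^(-|x|) costs -|x|, which accounts for the summand |x|. Because the closed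
form is a product of commuting factors, the recursion is consistent whatever the order in which the
indices are added. -/
lemma hypergeometricTerm_add_single (w : Fin (n + 1) → ℕ) (v : M) (x : Fin (n + 1) → ℕ)
    (i : Fin (n + 1)) :
    hypergeometricTerm D w v (x + Pi.single i 1) =
      (-(∑ i, w i : ℕ) : ℂ)⁻¹ • (T (-1) : CTau) • (euler D (hypergeometricTerm D w v x) +
        ((∑ i, x i : ℕ) - (∑ i, w i : ℕ) * x i / w i : ℂ) • hypergeometricTerm D w v x) := by
  have hs : ∑ j, (x + Pi.single i 1 : Fin (n + 1) → ℕ) j = ∑ j, x j + 1 := by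
    simp [Finset.sum_add_distrib]
  have hp : (∏ k, ∏ j ∈ Finset.range ((x + Pi.single i 1 : Fin (n + 1) → ℕ) k),
      (Polynomial.X - Polynomial.C (((∑ i, w i : ℕ) : ℂ) * j / w k))) =
      (Polynomial.X - Polynomial.C (((∑ i, w i : ℕ) : ℂ) * x i / w i)) *
      ∏ k, ∏ j ∈ Finset.range (x k),
      (Polynomial.X - Polynomial.C (((∑ i, w i : ℕ) : ℂ) * j / w k)) := by
    rw [← Finset.univ.mul_prod_erase _ (Finset.mem_univ i)]
    conv_rhs => rw [← Finset.univ.mul_prod_erase _ (Finset.mem_univ i), ← mul_assoc]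
    congr 1
    · rw [Pi.add_apply, Pi.single_eq_same, Finset.prod_range_succ, mul_comm]
    · refine Finset.prod_congr rfl fun k hk => ?_
      rw [Pi.add_apply, Pi.single_eq_of_ne (Finset.ne_of_mem_erase hk), add_zero]
  rw [hypergeometricTerm, hp, map_mul, Module.End.mul_apply, hs, pow_succ', mul_smul]
  unfold hypergeometricTerm
  set y := Polynomial.aeval (euler D) (∏ k, ∏ j ∈ Finset.range (x k),
      (Polynomial.X - Polynomial.C (((∑ i, w i : ℕ) : ℂ) * j / w k))) v
  rw [map_smul, euler_T_smul hD,
    smul_comm ((∑ i, x i : ℕ) - (∑ i, w i : ℕ) * x i / w i : ℂ), ← smul_add,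
    smul_comm_complex (T (-1))]
  congr 2
  rw [map_sub, Polynomial.aeval_X, Polynomial.aeval_C, LinearMap.sub_apply,
    Module.algebraMap_end_apply, ← smul_comm_complex, ← smul_add, T_smul_T_smul]
  congr 1
  · congr 1; push_cast; ring
  · rw [add_assoc, ← add_smul, sub_eq_add_neg, ← neg_smul]
    congr 2; push_cast; ring

end Connection

lemma pi_nat_induction {ι : Type*} [Fintype ι] [DecidableEq ι] {P : (ι → ℕ) → Prop}
    (zero : P 0) (add : ∀ x i, P x → P (x + Pi.single i 1)) (x : ι → ℕ) : P x := by
  induction h : ∑ i, x i generalizing x with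
  | zero =>
    have : x = 0 := funext fun i => by simpa using (Finset.sum_eq_zero_iff.1 h) i
    rwa [this]
  | succ k ih =>
    obtain ⟨i, -, hi⟩ : ∃ i ∈ Finset.univ, x i ≠ 0 := Finset.exists_ne_zero_of_sum_ne_zero (by lia)
    have hx : x = (x - Pi.single i 1) + Pi.single i 1 := by
      ext j
      rcases eq_or_ne j i with rfl | hj
      · simp; lia
      · simp [hj]
    rw [hx]
    refine add _ _ (ih _ ?_)
    have : ∑ j, x j = ∑ j, (x - Pi.single i 1 : ι → ℕ) j + 1 := by
      conv_lhs => rw [hx]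
      simp [Finset.sum_add_distrib]
    lia

/-! ### The model -/

section Model

variable (w : Fin (n + 1) → ℕ)

/-- The free `ℂ[τ, τ⁻¹]`-module with basis indexed by the integers modulo `μ`. -/
abbrev Model : Type := ZMod (∑ i, w i) → CTau

/-- The connection with `τ ∂_τ eₖ = -α(k) eₖ - μ τ eₖ₊₁`. -/
def modelConnection : Model w →ₗ[ℂ] Model w where
  toFun f z := dTau (f z) - (alpha w z : ℂ) • (T (-1) * f z) - ((∑ i, w i : ℕ) : ℂ) • f (z - 1)
  map_add' f g := by ext1 z; simp only [Pi.add_apply, map_add, mul_add, smul_add]; ring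
  map_smul' c f := by
    ext1 z
    simp only [Pi.smul_apply, map_smul, mul_smul_comm, RingHom.id_apply, smul_sub]
    rw [smul_comm c, smul_comm c]

lemma isConnection_model : IsConnection (modelConnection w) := by
  intro p f
  ext1 z
  simp only [modelConnection, LinearMap.coe_mk, AddHom.coe_mk, Pi.add_apply, Pi.smul_apply,
    smul_eq_mul, dTau_mul, smul_eq_C_mul]
  ring

lemma euler_model_single (z : ZMod (∑ i, w i)) :
    euler (modelConnection w) (Pi.single z 1) = -((alpha w z : ℂ) • (Pi.single z 1 : Model w)) -
      ((∑ i, w i : ℕ) : ℂ) • (T 1 : CTau) • (Pi.single (z + 1) 1 : Model w) := by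
  ext1 y
  have h1 : dTau (Pi.single (M := fun _ => CTau) z (1 : CTau) y) = 0 := by
    rcases eq_or_ne y z with rfl | h
    · rw [Pi.single_eq_same, ← T_zero, dTau_T]; simp
    · rw [Pi.single_eq_of_ne h, map_zero]
  have h2 : Pi.single (M := fun _ => CTau) z (1 : CTau) (y - 1) =
      Pi.single (M := fun _ => CTau) (z + 1) (1 : CTau) y := by
    simp only [Pi.single_apply, sub_eq_iff_eq_add]
  have h3 : (T 1 * T (-1) : CTau) = 1 := by rw [← T_add]; simp
  have h4 : Pi.single (M := fun _ => CTau) z (1 : CTau) y * C (alpha w y : ℂ) =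
      Pi.single (M := fun _ => CTau) z (1 : CTau) y * C (alpha w z : ℂ) := by
    rcases eq_or_ne y z with rfl | h
    · rfl
    · rw [Pi.single_eq_of_ne h, zero_mul, zero_mul]
  simp only [euler_apply, modelConnection, LinearMap.coe_mk, AddHom.coe_mk, Pi.sub_apply,
    Pi.smul_apply, Pi.neg_apply, smul_eq_mul, h1, h2, smul_eq_C_mul]
  linear_combination (-C (alpha w z : ℂ) * Pi.single (M := fun _ => CTau) z (1 : CTau) y) * h3 -
    T 1 * T (-1) * h4

end Model

/-! ### Images of the monomials uˣ in the model -/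

section ModelTerm

variable (w : Fin (n + 1) → ℕ)

/-- The element of the model which corresponds to the monomial `uˣ`. -/
def modelTerm (x : Fin (n + 1) → ℕ) : Model w :=
  hypergeometricTerm (modelConnection w) w (Pi.single 0 1) x

lemma modelTerm_add_single (x : Fin (n + 1) → ℕ) (i : Fin (n + 1)) :
    modelTerm w (x + Pi.single i 1) =
      (-(∑ i, w i : ℕ) : ℂ)⁻¹ • (T (-1) : CTau) • (euler (modelConnection w) (modelTerm w x) +
        ((∑ i, x i : ℕ) - (∑ i, w i : ℕ) * x i / w i : ℂ) • modelTerm w x) :=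
  hypergeometricTerm_add_single (isConnection_model w) w _ x i

variable {w} (hw : ∀ i, 0 < w i)
include hw

lemma sum_pos_of_pos : 0 < ∑ i, w i := Finset.sum_pos (fun i _ => hw i) Finset.univ_nonempty

lemma sum_cast_ne_zero : ((∑ i, w i : ℕ) : ℂ) ≠ 0 := Nat.cast_ne_zero.2 (sum_pos_of_pos hw).ne'

omit hw in
/-- The constant in the recursion for the monomials `uˣ`, along the sequence `a(k)`. -/
lemma coe_spectralNumber (k : ℕ) :
    ((∑ i, exponent w k i : ℕ) - (∑ i, w i : ℕ) * exponent w k (minIndex w (exponent w k)) /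
      w (minIndex w (exponent w k)) : ℂ) = (spectralNumber w k : ℂ) := by
  rw [sum_exponent, spectralNumber, level, mul_div_assoc]
  push_cast
  rfl

/-- The constant of the recursion at a(k) is α(k). It cancels the diagonal part of τ∂_τ eₖ, so only
eₖ₊₁ remains. -/
lemma modelTerm_exponent (k : ℕ) :
    modelTerm w (exponent w k) = Pi.single (k : ZMod (∑ i, w i)) 1 := by
  induction k with
  | zero => rw [exponent, modelTerm, hypergeometricTerm_zero, Nat.cast_zero]
  | succ k ih =>
    rw [exponent_succ, modelTerm_add_single, coe_spectralNumber, ih, euler_model_single,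
      alpha_natCast hw, neg_sub_left, neg_add_eq_sub, sub_add_eq_sub_sub_swap, sub_self, zero_sub,
      smul_neg, smul_neg, smul_comm_complex, T_smul_T_smul, neg_add_cancel, T_zero, one_smul,
      inv_neg, neg_smul, neg_neg, inv_smul_smul₀ (sum_cast_ne_zero hw), Nat.cast_succ]

/-- True at x = 0 because w = a(μ) has image e_μ = e₀. It propagates because |x| - μxᵢ/wᵢ does not
change when w is added to x. This is what lets the terms depend only on the function uˣ on the
torus. -/
lemma modelTerm_add_weights (x : Fin (n + 1) → ℕ) : modelTerm w (x + w) = modelTerm w x := by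
  induction x using pi_nat_induction with
  | zero =>
    have h1 := modelTerm_exponent hw (∑ i, w i)
    have h2 := modelTerm_exponent hw 0
    rw [exponent_sum hw, ZMod.natCast_self] at h1
    rw [exponent, Nat.cast_zero] at h2
    rw [zero_add, h1, h2]
  | add x i ih =>
    have h : (w i : ℂ) ≠ 0 := Nat.cast_ne_zero.2 (hw i).ne'
    rw [add_right_comm, modelTerm_add_single, modelTerm_add_single, ih]
    congr 4
    simp only [Pi.add_apply, Finset.sum_add_distrib, Nat.cast_add]
    rw [mul_add, add_div, mul_div_cancel_right₀ _ h]
    ring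

lemma modelTerm_add_nsmul (x : Fin (n + 1) → ℕ) (c : ℕ) :
    modelTerm w (x + c • w) = modelTerm w x := by
  induction c with
  | zero => rw [zero_smul, add_zero]
  | succ c ih => rw [succ_nsmul, ← add_assoc, modelTerm_add_weights hw, ih]

end ModelTerm

/-! ### The rows of a basis of the weight lattice -/

section Lattice

variable {w : Fin (n + 1) → ℕ} (b : Module.Basis (Fin n) ℤ (weightLattice w))

lemma mem_weightLattice {x : Fin (n + 1) → ℤ} : x ∈ weightLattice w ↔ ∑ i, (w i : ℤ) * x i = 0 := by
  simp [weightLattice]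

lemma sum_smul_row_apply (x : Fin (n + 1) → ℤ) (j : Fin n) :
    (∑ i, x i • row b i) j = ∑ i, x i * (b j : Fin (n + 1) → ℤ) i := by
  simp [row]

lemma sum_weight_smul_row : ∑ i, (w i : ℤ) • row b i = 0 := by
  ext j
  rw [sum_smul_row_apply]
  exact mem_weightLattice.1 (b j).2

lemma sum_mul_eq_zero_of_sum_smul_row {x : Fin (n + 1) → ℤ} (hx : ∑ i, x i • row b i = 0)
    {y : Fin (n + 1) → ℤ} (hy : y ∈ weightLattice w) : ∑ i, x i * y i = 0 := by
  let l : weightLattice w →ₗ[ℤ] ℤ :=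
    (∑ i, x i • (LinearMap.proj i : (Fin (n + 1) → ℤ) →ₗ[ℤ] ℤ)) ∘ₗ (weightLattice w).subtype
  have hl : l = 0 := b.ext fun j => by
    have := congrFun hx j
    rw [sum_smul_row_apply] at this
    simpa [l] using this
  simpa [l] using LinearMap.congr_fun hl ⟨y, hy⟩

variable (hw : ∀ i, 0 < w i) (hgcd : Finset.univ.gcd w = 1)
include hgcd

lemma exists_eq_smul_weight {x : Fin (n + 1) → ℤ} (hx : ∑ i, x i • row b i = 0) :
    ∃ c : ℤ, ∀ i, x i = c * w i := by
  obtain ⟨p, hp⟩ := exists_sum_mul_eq_one hgcd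
  refine ⟨∑ i, x i * p i, fun k => ?_⟩
  -- With ∑ pᵢwᵢ = 1, subtracting wₖ p projects the k-th unit vector into the weight lattice.
  have h := sum_mul_eq_zero_of_sum_smul_row b hx (y := Pi.single k 1 - (w k : ℤ) • p) (by
    rw [mem_weightLattice]
    simp only [Pi.sub_apply, Pi.smul_apply, smul_eq_mul, mul_sub, Finset.sum_sub_distrib,
      Pi.single_apply, mul_ite, mul_one, mul_zero, Finset.sum_ite_eq', Finset.mem_univ, if_true]
    rw [show ∑ i, (w i : ℤ) * (w k * p i) = w k * ∑ i, p i * w i by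
      rw [Finset.mul_sum]; exact Finset.sum_congr rfl fun i _ => by ring, hp]
    ring)
  simp only [Pi.sub_apply, Pi.smul_apply, smul_eq_mul, mul_sub, Finset.sum_sub_distrib,
      Pi.single_apply, mul_ite, mul_one, mul_zero, Finset.sum_ite_eq', Finset.mem_univ, if_true,
      sub_eq_zero] at h
  rw [h, Finset.sum_mul]
  exact Finset.sum_congr rfl fun i _ => by ring

/-- The vector `a` is a linear form on the weight lattice in the basis `b`. The projection y ↦ y -
(∑ wᵢyᵢ) p onto the lattice extends it to ℤⁿ⁺¹, and the values on the unit vectors are the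
coefficients. -/
lemma exists_sum_smul_row_eq_int (a : Fin n → ℤ) :
    ∃ x : Fin (n + 1) → ℤ, ∑ i, x i • row b i = a := by
  obtain ⟨p, hp⟩ := exists_sum_mul_eq_one hgcd
  have hmem (y : Fin (n + 1) → ℤ) : y - (∑ i, (w i : ℤ) * y i) • p ∈ weightLattice w := by
    rw [mem_weightLattice]
    simp only [Pi.sub_apply, Pi.smul_apply, smul_eq_mul, mul_sub, Finset.sum_sub_distrib]
    rw [show ∑ k, (w k : ℤ) * ((∑ i, (w i : ℤ) * y i) * p k) =
      (∑ i, (w i : ℤ) * y i) * ∑ i, p i * w i by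
        conv_rhs => rw [Finset.mul_sum]
        exact Finset.sum_congr rfl fun i _ => by ring, hp]
    ring
  refine ⟨fun i => b.constr ℤ a ⟨_, hmem (Pi.single i 1)⟩, ?_⟩
  ext j
  rw [sum_smul_row_apply]
  have h : b j = ∑ i, (b j : Fin (n + 1) → ℤ) i •
      (⟨_, hmem (Pi.single i 1)⟩ : weightLattice w) := by
    ext k
    have h0 := mem_weightLattice.1 (b j).2
    simp only [Submodule.coe_sum, Submodule.coe_smul, Finset.sum_apply, Pi.smul_apply,
      Pi.sub_apply, smul_eq_mul, mul_sub, Finset.sum_sub_distrib, Pi.single_apply, mul_ite, mul_one,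
      mul_zero, Finset.sum_ite_eq', Finset.sum_ite_eq, Finset.mem_univ, if_true]
    rw [show ∑ i, (b j : Fin (n + 1) → ℤ) i * (w i * p k) =
      (∑ i, (w i : ℤ) * (b j : Fin (n + 1) → ℤ) i) * p k by
        rw [Finset.sum_mul]; exact Finset.sum_congr rfl fun i _ => by ring, h0]
    ring
  have h1 := congrArg (b.constr ℤ a) h
  rw [Module.Basis.constr_basis, map_sum] at h1
  rw [h1]
  exact Finset.sum_congr rfl fun i _ => by rw [map_smul, smul_eq_mul, mul_comm]

include hw in
lemma exists_sum_smul_row_eq (a : Fin n → ℤ) :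
    ∃ x : Fin (n + 1) → ℕ, ∑ i, (x i : ℤ) • row b i = a := by
  obtain ⟨x, rfl⟩ := exists_sum_smul_row_eq_int b hgcd a
  set c := ∑ i, |x i|
  have h (i) : 0 ≤ x i + c * w i := by
    have h1 : |x i| ≤ c := Finset.single_le_sum (f := fun i => |x i|)
      (fun i _ => abs_nonneg _) (Finset.mem_univ i)
    have h2 := neg_abs_le (x i)
    have h3 : (1 : ℤ) ≤ w i := by exact_mod_cast hw i
    nlinarith [abs_nonneg (x i)]
  refine ⟨fun i => (x i + c * w i).toNat, ?_⟩
  simp only [Int.toNat_of_nonneg (h _), add_smul, Finset.sum_add_distrib, mul_smul,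
    ← Finset.smul_sum, sum_weight_smul_row, smul_zero, add_zero]

lemma exists_eq_add_nsmul {x y : Fin (n + 1) → ℕ}
    (h : ∑ i, (x i : ℤ) • row b i = ∑ i, (y i : ℤ) • row b i) :
    ∃ c : ℕ, x = y + c • w ∨ y = x + c • w := by
  obtain ⟨c, hc⟩ := exists_eq_smul_weight b hgcd (x := fun i => (x i : ℤ) - y i) (by
    simp only [sub_smul, Finset.sum_sub_distrib, h, sub_self])
  rcases Int.eq_nat_or_neg c with ⟨d, rfl | rfl⟩
  · refine ⟨d, Or.inl (funext fun i => ?_)⟩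
    have := hc i
    simp only [Pi.add_apply, Pi.smul_apply, smul_eq_mul]
    zify; linarith
  · refine ⟨d, Or.inr (funext fun i => ?_)⟩
    have := hc i
    simp only [Pi.add_apply, Pi.smul_apply, smul_eq_mul]
    zify; linarith

end Lattice

/-! ### The recursion in the Gauss-Manin system -/

section Recursion

lemma isConnection_connection (f : TorusRing n) : IsConnection (connection f) := by
  intro p x
  obtain ⟨φ, rfl⟩ := (relations f).mkQ_surjective x
  rw [← (relations f).mkQ.map_smul, connection_mk, connection_mk, coeffDTau_smul,
    ← (relations f).mkQ.map_smul, ← (relations f).mkQ.map_smul, ← map_add, smul_sub, mul_smul_comm,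
    add_sub_assoc]

variable {w : Fin (n + 1) → ℕ} (b : Module.Basis (Fin n) ℤ (weightLattice w))

/-- The class of `uˣ dv₁/v₁ ∧ ⋯ ∧ dvₙ/vₙ`. -/
def uMonomial (x : Fin (n + 1) → ℕ) : System (weightPoly b) :=
  monomialClass (weightPoly b) (∑ i, (x i : ℤ) • row b i)

lemma mkQ_single (f : TorusRing n) (a : Fin n → ℤ) (c : CTau) :
    (relations f).mkQ (AddMonoidAlgebra.single a c) = c • monomialClass f a := by
  rw [monomialClass, ← (relations f).mkQ.map_smul, AddMonoidAlgebra.smul_single, smul_eq_mul,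
    mul_one]

lemma incl_weightPoly :
    incl n (weightPoly b) = ∑ i, AddMonoidAlgebra.single (row b i) (C (w i : ℂ)) := by
  rw [weightPoly, map_sum]
  exact Finset.sum_congr rfl fun i _ => AddMonoidAlgebra.mapRingHom_single ..

lemma vdv_incl_weightPoly (j : Fin n) : vdv j (incl n (weightPoly b)) =
    ∑ i, AddMonoidAlgebra.single (row b i) ((row b i j : CTau) * C (w i : ℂ)) := by
  rw [incl_weightPoly, map_sum]
  exact Finset.sum_congr rfl fun i _ => vdv_single ..

lemma sum_smul_row_add_single (x : Fin (n + 1) → ℕ) (i : Fin (n + 1)) :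
    ∑ k, ((x + Pi.single i 1 : Fin (n + 1) → ℕ) k : ℤ) • row b k =
      row b i + ∑ k, (x k : ℤ) • row b k := by
  simp [Finset.sum_add_distrib, add_smul, Pi.single_apply, add_comm]

/-- The defining relation with φⱼ = uˣ, sorted by the variables uᵢ. Its coefficients are the
coordinates of a lattice vector, so it extends from the basis to every vector of the weight lattice.
-/
lemma relation_uMonomial (x : Fin (n + 1) → ℕ) (j : Fin n) :
    ∑ i, (b j : Fin (n + 1) → ℤ) i •
      ((x i : ℂ) • uMonomial b x -
        (w i : ℂ) • (T 1 : CTau) • uMonomial b (x + Pi.single i 1)) = 0 := by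
  set a := ∑ i, (x i : ℤ) • row b i with ha
  have h : (relations (weightPoly b)).mkQ (vdv j (AddMonoidAlgebra.single a 1) -
      (T 1 : CTau) • (vdv j (incl n (weightPoly b)) * AddMonoidAlgebra.single a 1)) = 0 := by
    rw [Submodule.mkQ_apply, Submodule.Quotient.mk_eq_zero]
    exact Submodule.subset_span ⟨j, _, rfl⟩
  have e (i) : uMonomial b (x + Pi.single i 1) = monomialClass (weightPoly b) (row b i + a) := by
    rw [uMonomial, sum_smul_row_add_single]
  have ea : (a j : CTau) = ∑ i, ((b j : Fin (n + 1) → ℤ) i : CTau) * C (x i : ℂ) := by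
    rw [ha, sum_smul_row_apply]
    push_cast
    exact Finset.sum_congr rfl fun i _ => by rw [map_natCast, mul_comm]
  rw [vdv_incl_weightPoly, vdv_single, Finset.sum_mul, map_sub, (relations _).mkQ.map_smul,
    map_sum] at h
  simp only [AddMonoidAlgebra.single_mul_single, mul_one, mkQ_single] at h
  rw [ea, Finset.sum_smul, Finset.smul_sum, ← Finset.sum_sub_distrib] at h
  rw [← h]
  refine Finset.sum_congr rfl fun i _ => ?_
  rw [← Int.cast_smul_eq_zsmul CTau, smul_sub, ← C_smul, ← C_smul, e, smul_smul, smul_smul,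
    smul_smul, smul_smul]
  congr 2
  rw [row]
  ring

lemma sum_smul_eq_zero_of_basis {G : Type*} [AddCommGroup G] {y : Fin (n + 1) → G}
    (hy : ∀ j, ∑ i, (b j : Fin (n + 1) → ℤ) i • y i = 0) {L : Fin (n + 1) → ℤ}
    (hL : L ∈ weightLattice w) : ∑ i, L i • y i = 0 := by
  let l : weightLattice w →ₗ[ℤ] G :=
    Fintype.linearCombination ℤ y ∘ₗ (weightLattice w).subtype
  have hl : l = 0 := b.ext fun j => by simpa [l, Fintype.linearCombination_apply] using hy j
  simpa [l, Fintype.linearCombination_apply] using LinearMap.congr_fun hl ⟨L, hL⟩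

lemma weight_smul_comm {G : Type*} [AddCommGroup G] {y : Fin (n + 1) → G}
    (hy : ∀ j, ∑ i, (b j : Fin (n + 1) → ℤ) i • y i = 0) (i k : Fin (n + 1)) :
    (w i : ℤ) • y k = (w k : ℤ) • y i := by
  have h := sum_smul_eq_zero_of_basis b hy (L := Pi.single k (w i : ℤ) - Pi.single i (w k : ℤ)) (by
    rw [mem_weightLattice]
    simp [mul_sub, Pi.single_apply, mul_comm])
  simpa [sub_smul, Pi.single_apply, sub_eq_zero] using h

lemma euler_uMonomial (x : Fin (n + 1) → ℕ) : euler (connection (weightPoly b)) (uMonomial b x) =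
    -∑ i, (w i : ℂ) • (T 1 : CTau) • uMonomial b (x + Pi.single i 1) := by
  set a := ∑ i, (x i : ℤ) • row b i with ha
  have e (i) : uMonomial b (x + Pi.single i 1) = monomialClass (weightPoly b) (row b i + a) := by
    rw [uMonomial, sum_smul_row_add_single]
  have h0 : dTau 1 = 0 := by rw [← T_zero, dTau_T]; simp
  rw [euler_apply, uMonomial, monomialClass, connection_mk, coeffDTau_single, h0,
    AddMonoidAlgebra.single_zero, zero_sub, map_neg, incl_weightPoly, Finset.sum_mul, map_sum,
    smul_neg, Finset.smul_sum]
  simp only [AddMonoidAlgebra.single_mul_single, mul_one, mkQ_single, e, C_smul, smul_comm_complex]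
  rfl

variable (hw : ∀ i, 0 < w i)
include hw

/-- Put yᵢ = xᵢ uˣ - wᵢ τ u^(x+1ᵢ). The lattice vectors supported on two coordinates give wₖ yᵢ = wᵢ
yₖ. Summing over k gives μ yᵢ = wᵢ ∑ yₖ = wᵢ (|x| + τ∂_τ) uˣ, which is solved for u^(x+1ᵢ). -/
lemma uMonomial_add_single (x : Fin (n + 1) → ℕ) (i : Fin (n + 1)) :
    uMonomial b (x + Pi.single i 1) = (-(∑ i, w i : ℕ) : ℂ)⁻¹ • (T (-1) : CTau) •
      (euler (connection (weightPoly b)) (uMonomial b x) +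
        ((∑ i, x i : ℕ) - (∑ i, w i : ℕ) * x i / w i : ℂ) • uMonomial b x) := by
  set y : Fin (n + 1) → System (weightPoly b) := fun i => (x i : ℂ) • uMonomial b x -
    (w i : ℂ) • (T 1 : CTau) • uMonomial b (x + Pi.single i 1) with hy
  have h1 : ∑ k, (w k : ℂ) • y i = ∑ k, (w i : ℂ) • y k := by
    refine Finset.sum_congr rfl fun k _ => ?_
    have := weight_smul_comm b (relation_uMonomial b x) i k
    rw [natCast_zsmul, natCast_zsmul] at this
    rw [Nat.cast_smul_eq_nsmul, Nat.cast_smul_eq_nsmul]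
    exact this.symm
  have hi : (w i : ℂ) ≠ 0 := Nat.cast_ne_zero.2 (hw i).ne'
  have h2 : ∑ k, y k = (∑ k, x k : ℕ) • uMonomial b x +
      euler (connection (weightPoly b)) (uMonomial b x) := by
    rw [euler_uMonomial, hy, Finset.sum_sub_distrib, ← sub_eq_add_neg, ← Finset.sum_smul,
      ← Nat.cast_sum, Nat.cast_smul_eq_nsmul]
  rw [← Finset.sum_smul, ← Finset.smul_sum, h2, ← Nat.cast_sum, ← Nat.cast_smul_eq_nsmul ℂ] at h1
  have h3 : euler (connection (weightPoly b)) (uMonomial b x) +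
      ((∑ i, x i : ℕ) - (∑ i, w i : ℕ) * x i / w i : ℂ) • uMonomial b x =
      -((∑ i, w i : ℕ) : ℂ) • (T 1 : CTau) • uMonomial b (x + Pi.single i 1) := by
    refine smul_right_injective _ hi ?_
    simp only [hy] at h1 ⊢
    have h4 : (w i : ℂ) * ((∑ i, w i : ℕ) * x i / w i) = (∑ i, w i : ℕ) * x i := by
      field_simp
    rw [smul_add, smul_smul, mul_sub, h4]
    rw [smul_sub, smul_smul, smul_smul, smul_add, smul_smul] at h1
    rw [sub_smul, smul_smul, mul_neg, neg_smul, add_sub_assoc', add_comm, sub_eq_iff_eq_add, ← h1,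
      mul_comm (w i : ℂ)]
    abel
  rw [h3, smul_comm_complex, T_smul_T_smul, neg_add_cancel, T_zero, one_smul,
    inv_smul_smul₀ (neg_ne_zero.2 (sum_cast_ne_zero hw))]

end Recursion

/-! ### The subrings `ℂ[τ]` and `ℂ[θ]` -/

section Adjoin

lemma adjoin_T_induction {e : ℤ} {P : CTau → Prop} {p : CTau} (hp : p ∈ Algebra.adjoin ℂ {T e})
    (add : ∀ p q, P p → P q → P (p + q)) (monomial : ∀ (m : ℕ) c, P (C c * T (m * e))) : P p := by
  rw [Algebra.adjoin_singleton_eq_range_aeval] at hp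
  obtain ⟨q, rfl⟩ := hp
  induction q using Polynomial.induction_on' with
  | add p q hp hq =>
    have := add _ _ hp hq
    rwa [← map_add] at this
  | monomial m c =>
    have := monomial m c
    rwa [← T_pow, C_eq_algebraMap, ← Polynomial.aeval_monomial] at this

lemma C_mul_T_mem_adjoin (e : ℤ) (c : ℂ) (m : ℕ) :
    (C c * T (m * e) : CTau) ∈ Algebra.adjoin ℂ {(T e : CTau)} := by
  rw [← T_pow, ← smul_eq_C_mul]
  exact Subalgebra.smul_mem _ (pow_mem (Algebra.subset_adjoin (Set.mem_singleton _)) m) c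

lemma T_one_mul_dTau_mem_adjoin {e : ℤ} {p : CTau} (hp : p ∈ Algebra.adjoin ℂ {(T e : CTau)}) :
    T 1 * dTau p ∈ Algebra.adjoin ℂ {(T e : CTau)} := by
  refine adjoin_T_induction (P := fun p => T 1 * dTau p ∈ Algebra.adjoin ℂ {(T e : CTau)}) hp
    (fun p q hp hq => ?_) fun m c => ?_
  · rw [map_add, mul_add]
    exact add_mem hp hq
  · rw [← smul_eq_C_mul, map_smul, mul_smul_comm, T_one_mul_dTau_T, smul_smul, smul_eq_C_mul]
    exact C_mul_T_mem_adjoin e _ m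

lemma C_mem_adjoin (e : ℤ) (c : ℂ) : (C c : CTau) ∈ Algebra.adjoin ℂ {(T e : CTau)} :=
  Subalgebra.algebraMap_mem _ c

end Adjoin

/-! ### The basis `(ω_k)` of the Gauss-Manin system -/

section Basis

variable {w : Fin (n + 1) → ℕ} (b : Module.Basis (Fin n) ℤ (weightLattice w))
  (hw : ∀ i, 0 < w i) (hgcd : Finset.univ.gcd w = 1)

/-- Separates a part that is wᵢ times a vector independent of i. A lattice vector annihilates that
part, which is why the relations go to zero in `preToModel_relation`. -/
lemma weight_smul_modelTerm (hw : ∀ i, 0 < w i) (x : Fin (n + 1) → ℕ) (i : Fin (n + 1)) :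
    (w i : ℂ) • (T 1 : CTau) • modelTerm w (x + Pi.single i 1) =
      (w i : ℂ) • (-(∑ i, w i : ℕ) : ℂ)⁻¹ • (euler (modelConnection w) (modelTerm w x) +
        ((∑ i, x i : ℕ) : ℂ) • modelTerm w x) + (x i : ℂ) • modelTerm w x := by
  have hi : (w i : ℂ) ≠ 0 := Nat.cast_ne_zero.2 (hw i).ne'
  have hs := sum_cast_ne_zero hw
  rw [modelTerm_add_single, smul_comm_complex, T_smul_T_smul, add_neg_cancel, T_zero, one_smul,
    sub_smul, add_sub_assoc', smul_sub, smul_sub, sub_eq_add_neg, smul_smul _ _ (modelTerm w x),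
    smul_smul _ _ (modelTerm w x), ← neg_smul]
  congr 2
  field_simp

include hw hgcd

/-- The map to the model which sends `uˣ` to the corresponding term. -/
def preToModel : TorusRingTau n →ₗ[CTau] Model w :=
  Finsupp.linearCombination CTau
    (fun a => modelTerm w (exists_sum_smul_row_eq b hw hgcd a).choose) ∘ₗ
    (AddMonoidAlgebra.coeffLinearEquiv CTau).toLinearMap

lemma preToModel_single (x : Fin (n + 1) → ℕ) (c : CTau) :
    preToModel b hw hgcd (AddMonoidAlgebra.single (∑ i, (x i : ℤ) • row b i) c) =
      c • modelTerm w x := by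
  rw [preToModel, LinearMap.comp_apply]
  change Finsupp.linearCombination CTau _ (Finsupp.single _ c) = _
  rw [Finsupp.linearCombination_single]
  congr 1
  have h := (exists_sum_smul_row_eq b hw hgcd (∑ i, (x i : ℤ) • row b i)).choose_spec
  obtain ⟨c, hc | hc⟩ := exists_eq_add_nsmul b hgcd h
  · rw [hc, modelTerm_add_nsmul hw]
  · conv_rhs => rw [hc, modelTerm_add_nsmul hw]

lemma preToModel_relation (j : Fin n) (φ : TorusRingTau n) :
    preToModel b hw hgcd
      (vdv j φ - (T 1 : CTau) • (vdv j (incl n (weightPoly b)) * φ)) = 0 := by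
  induction φ using AddMonoidAlgebra.induction_linear with
  | zero => simp
  | add φ ψ hφ hψ =>
    rw [map_add, mul_add, smul_add, add_sub_add_comm, map_add, hφ, hψ, add_zero]
  | single a c =>
    obtain ⟨x, rfl⟩ := exists_sum_smul_row_eq b hw hgcd a
    rw [vdv_single, vdv_incl_weightPoly, Finset.sum_mul, map_sub,
      (preToModel b hw hgcd).map_smul, map_sum, preToModel_single]
    simp only [AddMonoidAlgebra.single_mul_single, ← sum_smul_row_add_single, preToModel_single]
    have h (i) : (T 1 : CTau) • ((row b i j : CTau) * C (w i : ℂ) * c) •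
        modelTerm w (x + Pi.single i 1) = c • (row b i j : CTau) •
          ((w i : ℂ) • (-(∑ i, w i : ℕ) : ℂ)⁻¹ • (euler (modelConnection w) (modelTerm w x) +
        ((∑ i, x i : ℕ) : ℂ) • modelTerm w x) + (x i : ℂ) • modelTerm w x) := by
      rw [← weight_smul_modelTerm hw, ← C_smul, smul_smul, smul_smul, smul_smul, smul_smul]
      congr 1
      ring
    have h2 : ∑ i, (row b i j : CTau) * C (w i : ℂ) = 0 := by
      have := congrFun (sum_weight_smul_row b) j
      rw [sum_smul_row_apply, Pi.zero_apply] at this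
      have := congrArg (Int.cast : ℤ → CTau) this
      push_cast at this
      rw [← this]
      exact Finset.sum_congr rfl fun i _ => by rw [map_natCast, mul_comm]; rfl
    have h3 : (((∑ i, (x i : ℤ) • row b i) j : ℤ) : CTau) =
        ∑ i, (row b i j : CTau) * C (x i : ℂ) := by
      rw [sum_smul_row_apply]
      push_cast
      exact Finset.sum_congr rfl fun i _ => by rw [map_natCast, mul_comm]; rfl
    rw [Finset.smul_sum]
    simp only [h]
    generalize euler (modelConnection w) (modelTerm w x) + ((∑ i, x i : ℕ) : ℂ) • modelTerm w x = t
    simp only [smul_add]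
    rw [Finset.sum_add_distrib, ← Finset.smul_sum, ← Finset.smul_sum]
    simp only [← C_smul (w _ : ℂ), ← C_smul (x _ : ℂ), smul_smul _ (C _ : CTau)]
    rw [← Finset.sum_smul, ← Finset.sum_smul, h2, ← h3, zero_smul, smul_zero, zero_add, smul_smul,
      mul_comm, sub_self]

/-- The map from the Gauss-Manin system to the model. -/
def toModel : System (weightPoly b) →ₗ[CTau] Model w :=
  (relations (weightPoly b)).liftQ (preToModel b hw hgcd) (by
    rw [relations, Submodule.span_le]
    rintro _ ⟨j, φ, rfl⟩
    exact preToModel_relation b hw hgcd j φ)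

lemma toModel_uMonomial (x : Fin (n + 1) → ℕ) :
    toModel b hw hgcd (uMonomial b x) = modelTerm w x := by
  rw [toModel, uMonomial, monomialClass, Submodule.mkQ_apply, Submodule.liftQ_apply,
    preToModel_single, one_smul]

omit hgcd hw in
lemma omega_eq_uMonomial (k : ℕ) : omega b k = uMonomial b (exponent w k) := rfl

omit hw hgcd in
lemma uMonomial_add_weights (x : Fin (n + 1) → ℕ) : uMonomial b (x + w) = uMonomial b x := by
  rw [uMonomial, uMonomial]
  congr 1
  simp only [Pi.add_apply, Nat.cast_add, add_smul, Finset.sum_add_distrib, sum_weight_smul_row,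
    add_zero]

omit hgcd in
lemma omega_mod (k : ℕ) : omega b (k % ∑ i, w i) = omega b k :=
  Function.Periodic.map_mod_nat (f := omega b) (fun k => by
    rw [omega_eq_uMonomial, omega_eq_uMonomial, exponent_add_sum hw, uMonomial_add_weights b]) k

omit hw hgcd in
/-- The classes `ω_k`, indexed by `k` modulo `μ`. -/
def cyclicOmega (z : ZMod (∑ i, w i)) : System (weightPoly b) := omega b z.val

omit hgcd in
lemma cyclicOmega_natCast (k : ℕ) : cyclicOmega b k = omega b k := by
  rw [cyclicOmega, ZMod.val_natCast, omega_mod b hw]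

omit hgcd in
lemma euler_omega (k : ℕ) : euler (connection (weightPoly b)) (omega b k) =
    -((spectralNumber w k : ℂ) • omega b k) -
      ((∑ i, w i : ℕ) : ℂ) • (T 1 : CTau) • omega b (k + 1) := by
  have hs := sum_cast_ne_zero hw
  rw [omega_eq_uMonomial b (k + 1), exponent_succ, uMonomial_add_single b hw,
    coe_spectralNumber, smul_comm_complex, T_smul_T_smul, add_neg_cancel, T_zero, one_smul,
    smul_smul, inv_neg, mul_neg, mul_inv_cancel₀ hs, neg_one_smul, omega_eq_uMonomial]
  abel

variable [NeZero (∑ i, w i)]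

omit hgcd in
lemma euler_cyclicOmega (z : ZMod (∑ i, w i)) :
    euler (connection (weightPoly b)) (cyclicOmega b z) =
      -((alpha w z : ℂ) • cyclicOmega b z) -
        ((∑ i, w i : ℕ) : ℂ) • (T 1 : CTau) • cyclicOmega b (z + 1) := by
  obtain ⟨k, rfl⟩ := ZMod.natCast_zmod_surjective z
  rw [← Nat.cast_add_one, cyclicOmega_natCast b hw, cyclicOmega_natCast b hw, alpha_natCast hw]
  exact euler_omega b hw k

lemma toModel_cyclicOmega (z : ZMod (∑ i, w i)) :
    toModel b hw hgcd (cyclicOmega b z) = Pi.single z 1 := by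
  obtain ⟨k, rfl⟩ := ZMod.natCast_zmod_surjective z
  rw [cyclicOmega_natCast b hw, omega_eq_uMonomial, toModel_uMonomial, modelTerm_exponent hw]

omit hgcd in
-- The recursion only uses θ and θ·τ∂_τ, and both preserve the ℂ[θ]-span of the ω_k.
lemma uMonomial_mem_span (x : Fin (n + 1) → ℕ) :
    uMonomial b x ∈ Submodule.span thetaPoly (Set.range (cyclicOmega b)) := by
  set L := Submodule.span thetaPoly (Set.range (cyclicOmega b))
  have hC (c : ℂ) {y} (hy : y ∈ L) : c • y ∈ L := by
    rw [← C_smul]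
    exact L.smul_mem ⟨_, C_mem_adjoin (-1) c⟩ hy
  have hθ {y} (hy : y ∈ L) : (T (-1) : CTau) • y ∈ L :=
    L.smul_mem ⟨T (-1), Algebra.subset_adjoin (Set.mem_singleton _)⟩ hy
  have hE {y} (hy : y ∈ L) : (T (-1) : CTau) • euler (connection (weightPoly b)) y ∈ L := by
    induction hy using Submodule.span_induction with
    | mem y hy =>
      obtain ⟨z, rfl⟩ := hy
      rw [euler_cyclicOmega b hw, smul_sub, smul_neg, smul_comm_complex, smul_comm_complex,
        T_smul_T_smul, neg_add_cancel, T_zero, one_smul]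
      exact sub_mem (neg_mem (hC _ (hθ (Submodule.subset_span ⟨z, rfl⟩))))
        (hC _ (Submodule.subset_span ⟨z + 1, rfl⟩))
    | zero => rw [map_zero, smul_zero]; exact zero_mem _
    | add y z _ _ hy hz => rw [map_add, smul_add]; exact add_mem hy hz
    | smul p y hy h =>
      change (T (-1) : CTau) • euler (connection (weightPoly b)) ((p : CTau) • y) ∈ L
      rw [euler_smul (isConnection_connection _), smul_add, smul_comm (T (-1)),
        smul_comm (T (-1)) (p : CTau)]
      exact add_mem (L.smul_mem ⟨_, T_one_mul_dTau_mem_adjoin p.2⟩ (hθ hy)) (L.smul_mem p h)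
  induction x using pi_nat_induction with
  | zero => exact Submodule.subset_span ⟨0, by rw [cyclicOmega, ZMod.val_zero]; rfl⟩
  | add x i ih =>
    rw [uMonomial_add_single b hw, smul_add, smul_comm_complex]
    exact hC _ (add_mem (hE ih) (hC _ (hθ ih)))

lemma brieskorn_le_span :
    brieskorn (weightPoly b) ≤ Submodule.span thetaPoly (Set.range (cyclicOmega b)) := by
  rw [brieskorn, Submodule.span_le]
  rintro _ ⟨a, rfl⟩
  obtain ⟨x, rfl⟩ := exists_sum_smul_row_eq b hw hgcd a
  exact uMonomial_mem_span b hw x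

lemma span_cyclicOmega : Submodule.span CTau (Set.range (cyclicOmega b)) = ⊤ := by
  rw [eq_top_iff]
  intro y _
  obtain ⟨φ, rfl⟩ := (relations (weightPoly b)).mkQ_surjective y
  induction φ using AddMonoidAlgebra.induction_linear with
  | zero => rw [map_zero]; exact zero_mem _
  | add φ ψ hφ hψ => rw [map_add]; exact add_mem (hφ trivial) (hψ trivial)
  | single a c =>
    rw [mkQ_single]
    refine Submodule.smul_mem _ _ ?_
    exact Submodule.span_le_restrictScalars thetaPoly CTau _
      (brieskorn_le_span b hw hgcd (Submodule.subset_span ⟨a, rfl⟩))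

lemma linearIndependent_cyclicOmega : LinearIndependent CTau (cyclicOmega b) := by
  refine LinearIndependent.of_comp (toModel b hw hgcd) ?_
  have h : ⇑(toModel b hw hgcd) ∘ cyclicOmega b = Pi.basisFun CTau (ZMod (∑ i, w i)) := by
    ext1 z
    rw [Function.comp_apply, toModel_cyclicOmega, Pi.basisFun_apply]
  rw [h]
  exact (Pi.basisFun CTau _).linearIndependent

/-- The basis `(ω_k)` of the Gauss-Manin system. -/
def omegaBasis : Module.Basis (ZMod (∑ i, w i)) CTau (System (weightPoly b)) :=
  .mk (linearIndependent_cyclicOmega b hw hgcd) (span_cyclicOmega b hw hgcd).ge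

lemma omegaBasis_apply (z : ZMod (∑ i, w i)) : omegaBasis b hw hgcd z = cyclicOmega b z :=
  Module.Basis.mk_apply ..

end Basis

/-! ### Uniqueness of the Malgrange-Kashiwara filtration -/

section Uniqueness

variable {M : Type*} [AddCommGroup M] [Module CTau M] [Module ℂ M] [IsScalarTower ℂ CTau M]

omit [Module CTau M] [IsScalarTower ℂ CTau M] in
-- The polynomials (X + a)ᵏ and (X + b)ˡ are coprime. The induction on k + l brings both E + a and E
-- + b applied to x into `K`, and their difference is a nonzero scalar.
lemma mem_of_pow_apply_mem {E : M →ₗ[ℂ] M} {K : Submodule ℂ M} (hK : ∀ x ∈ K, E x ∈ K) {a b : ℂ}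
    (hab : a ≠ b) {k l : ℕ} {x : M} (ha : ((E + algebraMap ℂ (Module.End ℂ M) a) ^ k) x ∈ K)
    (hb : ((E + algebraMap ℂ (Module.End ℂ M) b) ^ l) x ∈ K) : x ∈ K := by
  have hstep (c : ℂ) {y} (hy : y ∈ K) : (E + algebraMap ℂ (Module.End ℂ M) c) y ∈ K :=
    add_mem (hK y hy) (K.smul_mem c hy)
  have hc (c d : ℂ) : Commute (E + algebraMap ℂ (Module.End ℂ M) c)
      (E + algebraMap ℂ (Module.End ℂ M) d) :=
    ((Commute.refl E).add_left (Algebra.commutes c E)).add_right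
      (Algebra.commutes d (E + algebraMap ℂ (Module.End ℂ M) c)).symm
  induction h : k + l generalizing k l x with
  | zero =>
    obtain rfl : k = 0 := by lia
    exact ha
  | succ s ih =>
    rcases k with _ | k
    · exact ha
    rcases l with _ | l
    · exact hb
    have h1 : (E + algebraMap ℂ (Module.End ℂ M) a) x ∈ K := by
      refine ih (k := k) (l := l + 1) ?_ ?_ (by lia)
      · rwa [pow_succ] at ha
      · rw [← Module.End.mul_apply, ← ((hc a b).pow_right _).eq]
        exact hstep a hb
    have h2 : (E + algebraMap ℂ (Module.End ℂ M) b) x ∈ K := by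
      refine ih (k := k + 1) (l := l) ?_ ?_ (by lia)
      · rw [← Module.End.mul_apply, ← ((hc b a).pow_right _).eq]
        exact hstep b ha
      · rwa [pow_succ] at hb
    have h3 : (a - b) • x ∈ K := by
      have := sub_mem h1 h2
      rwa [LinearMap.add_apply, LinearMap.add_apply, add_sub_add_left_eq_sub,
        Module.algebraMap_end_apply, Module.algebraMap_end_apply, ← sub_smul] at this
    exact (K.smul_mem_iff (sub_ne_zero.2 hab)).1 h3

omit [Module CTau M] [IsScalarTower ℂ CTau M] in
/-- Nested filtrations with nilpotent action, indexed by the integers, are comparable. -/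
lemma le_of_nilpotent {E : M →ₗ[ℂ] M} {c : ℤ → ℂ} (hc : Function.Injective c)
    {W W' : ℤ → Submodule ℂ M} (mono' : Monotone W')
    (stable : ∀ k, ∀ x ∈ W k, E x ∈ W k) (stable' : ∀ k, ∀ x ∈ W' k, E x ∈ W' k)
    (nil : ∀ k, ∃ m : ℕ, ∀ x ∈ W k, ((E + algebraMap ℂ (Module.End ℂ M) (c k)) ^ m) x ∈ W (k - 1))
    (nil' : ∀ k, ∃ m : ℕ, ∀ x ∈ W' k,
      ((E + algebraMap ℂ (Module.End ℂ M) (c k)) ^ m) x ∈ W' (k - 1))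
    (up : ∀ k, ∃ l, W k ≤ W' l) (down : ∀ k l, ∃ t : ℕ, W (k - t) ≤ W' l) (k : ℤ) :
    W k ≤ W' k := by
  have hpow {K : Submodule ℂ M} (hK : ∀ x ∈ K, E x ∈ K) (a : ℂ) (m : ℕ) {x} (hx : x ∈ K) :
      ((E + algebraMap ℂ (Module.End ℂ M) a) ^ m) x ∈ K := by
    induction m with
    | zero => exact hx
    | succ m ih => rw [pow_succ']; exact add_mem (hK _ ih) (K.smul_mem a ih)
  -- Modulo the right-hand side both E + c(j) and E + c(l) act nilpotently on the intersection, with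
  -- c(j) ≠ c(l).
  have step {j l : ℤ} (h : j < l) : W j ⊓ W' l ≤ (W (j - 1) ⊓ W' l) ⊔ W' (l - 1) := by
    rintro x ⟨hx, hx'⟩
    obtain ⟨m, hm⟩ := nil j
    obtain ⟨m', hm'⟩ := nil' l
    refine mem_of_pow_apply_mem (E := E) (k := m) (l := m') ?_ (hc.ne h.ne)
      (Submodule.mem_sup_left ⟨hm x hx, hpow (stable' l) _ _ hx'⟩)
      (Submodule.mem_sup_right (hm' x hx'))
    intro y hy
    obtain ⟨u, ⟨hu, hu'⟩, v, hv, rfl⟩ := Submodule.mem_sup.1 hy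
    rw [map_add]
    exact add_mem (Submodule.mem_sup_left ⟨stable _ u hu, stable' _ u hu'⟩)
      (Submodule.mem_sup_right (stable' _ v hv))
  have steps {j l : ℤ} (h : j < l) (t : ℕ) :
      W j ⊓ W' l ≤ (W (j - t) ⊓ W' l) ⊔ W' (l - 1) := by
    induction t with
    | zero => simp
    | succ t ih =>
      refine ih.trans (sup_le ((step (by lia)).trans ?_) le_sup_right)
      rw [Nat.cast_succ, sub_add_eq_sub_sub]
  have drop {j l : ℤ} (h : j < l) : W j ⊓ W' l ≤ W' (l - 1) := by
    obtain ⟨t, ht⟩ := down j (l - 1)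
    exact (steps h t).trans (sup_le (inf_le_left.trans ht) le_rfl)
  -- As long as the index on the right exceeds k, `drop` lowers it by one.
  have key (d : ℕ) (h : W k ≤ W' (k + d)) : W k ≤ W' k := by
    induction d with
    | zero => simpa using h
    | succ d ih =>
      refine ih ((le_inf le_rfl h).trans ((drop (by lia)).trans (mono' (by lia))))
  obtain ⟨l, hl⟩ := up k
  exact key (l - k).toNat (hl.trans (mono' (by lia)))

variable {D : M →ₗ[ℂ] M} {V V' : ℚ → Submodule tauPoly M}

lemma eulerShift_eq (α : ℚ) :
    eulerShift (⇑D) α = ⇑(euler D + algebraMap ℂ (Module.End ℂ M) (α : ℂ)) := by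
  ext1 x
  rw [eulerShift, LinearMap.add_apply, Module.algebraMap_end_apply, C_smul, euler_apply]

lemma eulerShift_iterate (α : ℚ) (m : ℕ) (x : M) : (eulerShift (⇑D) α)^[m] x =
    ((euler D + algebraMap ℂ (Module.End ℂ M) (α : ℂ)) ^ m) x := by
  rw [eulerShift_eq, Module.End.pow_apply]

namespace IsVFiltration

omit [Module ℂ M] [IsScalarTower ℂ CTau M] in
-- Allows two filtrations to be indexed by the same (1/N)ℤ.
lemma eq_floor_of_dvd (hmono : Monotone V) {N N' : ℕ} (hN : 0 < N) (hN' : 0 < N') (h : N ∣ N')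
    (hV : ∀ α : ℚ, V α = V ((⌊(N : ℚ) * α⌋ : ℚ) / N)) (α : ℚ) :
    V α = V ((⌊(N' : ℚ) * α⌋ : ℚ) / N') := by
  have hN0 : (0 : ℚ) < N := by exact_mod_cast hN
  have hN0' : (0 : ℚ) < N' := by exact_mod_cast hN'
  refine le_antisymm ?_ (hmono ?_)
  · rw [hV α]
    refine hmono ?_
    obtain ⟨d, rfl⟩ := h
    rw [div_le_div_iff₀ hN0 hN0']
    have h1 : (⌊(N : ℚ) * α⌋ : ℚ) * d ≤ ⌊((N * d : ℕ) : ℚ) * α⌋ := by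
      have : ⌊(N : ℚ) * α⌋ * (d : ℤ) ≤ ⌊((N * d : ℕ) : ℚ) * α⌋ := by
        rw [Int.le_floor]
        push_cast
        have := Int.floor_le ((N : ℚ) * α)
        nlinarith [Nat.cast_nonneg (α := ℚ) d]
      exact_mod_cast this
    push_cast at h1 ⊢
    nlinarith
  · rw [div_le_iff₀ hN0', mul_comm]
    exact Int.floor_le _

omit [Module ℂ M] [IsScalarTower ℂ CTau M] in
lemma below_le (hmono : Monotone V) {N : ℕ} (hN : 0 < N)
    (hV : ∀ α : ℚ, V α = V ((⌊(N : ℚ) * α⌋ : ℚ) / N)) (k : ℤ) :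
    below V ((k : ℚ) / N) ≤ V (((k - 1 : ℤ) : ℚ) / N) := by
  have hN0 : (0 : ℚ) < N := by exact_mod_cast hN
  refine iSup_le fun ⟨β, hβ⟩ => ?_
  rw [hV β]
  refine hmono (div_le_div_of_nonneg_right ?_ hN0.le)
  rw [Int.cast_le, Int.le_sub_one_iff, Int.floor_lt]
  rwa [lt_div_iff₀ hN0, mul_comm] at hβ

omit [IsScalarTower ℂ CTau M] in
lemma shift_pow (h : IsVFiltration (⇑D) V) (t : ℕ) (α : ℚ) (x : M) :
    x ∈ V α ↔ (T t : CTau) • x ∈ V (α - t) := by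
  induction t with
  | zero => simp
  | succ t ih =>
    rw [ih, h.shift, T_smul_T_smul, Nat.cast_succ, Nat.cast_succ, add_comm (1 : ℤ),
      sub_add_eq_sub_sub]

omit [IsScalarTower ℂ CTau M] in
lemma exists_le (h : IsVFiltration (⇑D) V) (h' : IsVFiltration (⇑D) V') (α : ℚ) :
    ∃ β, V α ≤ V' β := by
  obtain ⟨s, hs⟩ := h.fg α
  choose β hβ using h'.exhaustive
  obtain ⟨c, hc⟩ := (s.image β).exists_le
  refine ⟨c, ?_⟩
  rw [← hs, Submodule.span_le]
  intro x hx
  exact h'.mono (hc _ (Finset.mem_image_of_mem _ hx)) (hβ x)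

theorem le (h : IsVFiltration (⇑D) V) (h' : IsVFiltration (⇑D) V') (α : ℚ) : V α ≤ V' α := by
  obtain ⟨N₁, hN₁, hV₁⟩ := h.discrete
  obtain ⟨N₂, hN₂, hV₂⟩ := h'.discrete
  set N := N₁ * N₂ with hNdef
  have hN : 0 < N := Nat.mul_pos hN₁ hN₂
  have hN0 : (0 : ℚ) < N := by exact_mod_cast hN
  have hV := eq_floor_of_dvd h.mono hN₁ hN (Dvd.intro _ rfl) hV₁
  have hV' := eq_floor_of_dvd h'.mono hN₂ hN (Dvd.intro_left _ rfl) hV₂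
  have hm : Monotone fun k : ℤ => (k : ℚ) / N := fun k l hkl =>
    div_le_div_of_nonneg_right (Int.cast_le.2 hkl) hN0.le
  have up (β : ℚ) : ∃ l : ℤ, V β ≤ V' ((l : ℚ) / N) := by
    obtain ⟨γ, hγ⟩ := exists_le h h' β
    exact ⟨_, hγ.trans (hV' γ).le⟩
  have key (k : ℤ) :
      (V ((k : ℚ) / N)).restrictScalars ℂ ≤ (V' ((k : ℚ) / N)).restrictScalars ℂ := by
    refine le_of_nilpotent (E := euler D) (c := fun k => (((k : ℚ) / N : ℚ) : ℂ))
      (W := fun k => (V ((k : ℚ) / N)).restrictScalars ℂ)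
      (W' := fun k => (V' ((k : ℚ) / N)).restrictScalars ℂ) ?_ ?_ ?_ ?_ ?_ ?_ ?_ ?_ k
    · intro k l hkl
      have : (k : ℚ) / N = (l : ℚ) / N := Rat.cast_injective hkl
      rw [div_left_inj' hN0.ne'] at this
      exact_mod_cast this
    · exact fun k l hkl => h'.mono (hm hkl)
    · exact fun k x hx => h.stable _ x hx
    · exact fun k x hx => h'.stable _ x hx
    · intro k
      obtain ⟨m, hx⟩ := h.nilpotent ((k : ℚ) / N)
      refine ⟨m, fun x hxV => ?_⟩
      rw [← eulerShift_iterate]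
      exact below_le h.mono hN hV k (hx x hxV)
    · intro k
      obtain ⟨m, hx⟩ := h'.nilpotent ((k : ℚ) / N)
      refine ⟨m, fun x hxV => ?_⟩
      rw [← eulerShift_iterate]
      exact below_le h'.mono hN hV' k (hx x hxV)
    · exact fun k => up _
    · intro k l
      obtain ⟨K, hK⟩ := up ((k : ℚ) / N)
      -- Multiplication by τᵗ lowers both filtrations by t, that is, by N t steps. So one inclusion
      -- of V_{k/N} into V'_{K/N} yields inclusions arbitrarily far down.
      refine ⟨N * (K - l).toNat, fun x hx => ?_⟩
      set t := (K - l).toNat with ht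
      have e : ((k - (N * t : ℕ) : ℤ) : ℚ) / N = (k : ℚ) / N - t := by
        push_cast; field_simp
      change x ∈ V (((k - (N * t : ℕ) : ℤ) : ℚ) / N) at hx
      have hx2 : (T (-(t : ℤ)) : CTau) • x ∈ V ((k : ℚ) / N) := by
        rw [h.shift_pow t, T_smul_T_smul, add_neg_cancel, T_zero, one_smul, ← e]
        exact hx
      have hx3 := (h'.shift_pow t _ _).1 (hK hx2)
      rw [T_smul_T_smul, add_neg_cancel, T_zero, one_smul] at hx3
      refine h'.mono ?_ hx3
      rw [sub_le_iff_le_add, ← sub_le_iff_le_add', ← sub_div, div_le_iff₀ hN0]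
      have h1 : (1 : ℚ) ≤ N := by exact_mod_cast hN
      have h2 : (K : ℚ) - l ≤ t := by
        have : K - l ≤ (t : ℤ) := Int.self_le_toNat _
        exact_mod_cast this
      nlinarith [Nat.cast_nonneg (α := ℚ) t]
  rw [hV α, hV' α]
  exact key _

theorem unique (h : IsVFiltration (⇑D) V) (h' : IsVFiltration (⇑D) V') : V = V' :=
  funext fun α => le_antisymm (h.le h' α) (h'.le h α)

end IsVFiltration

end Uniqueness

/-! ### The filtration defined by a basis -/

section OrderFiltration

variable {M : Type*} [AddCommGroup M] [Module CTau M] {m : ℕ}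

/-- The `ℂ[τ]`-submodule generated by the `τʲ eₖ` with `P k j`. -/
def monomialSpan (e : ZMod m → M) (P : ZMod m → ℤ → Prop) : Submodule tauPoly M :=
  Submodule.span tauPoly {y | ∃ z j, P z j ∧ y = (T j : CTau) • e z}

/-- The filtration for which `τʲ eₖ` has order `α(k) - j`. -/
def orderFiltration (e : ZMod m → M) (a : ZMod m → ℚ) (α : ℚ) : Submodule tauPoly M :=
  monomialSpan e fun z j => a z - j ≤ α

variable {e : ZMod m → M} {a : ZMod m → ℚ}

lemma monomialSpan_mono {P Q : ZMod m → ℤ → Prop} (h : ∀ z j, P z j → Q z j) :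
    monomialSpan e P ≤ monomialSpan e Q :=
  Submodule.span_mono fun _ ⟨z, j, hz, hy⟩ => ⟨z, j, h z j hz, hy⟩

lemma T_smul_mem_monomialSpan {P : ZMod m → ℤ → Prop} {z : ZMod m} {j : ℤ} (h : P z j) :
    (T j : CTau) • e z ∈ monomialSpan e P :=
  Submodule.subset_span ⟨z, j, h, rfl⟩

lemma smul_mem_of_mem_tauPoly {L : Submodule tauPoly M} {p : CTau} (hp : p ∈ tauPoly) {x : M}
    (hx : x ∈ L) : p • x ∈ L :=
  L.smul_mem ⟨p, hp⟩ hx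

lemma T_smul_mem_monomialSpan_of_mem {P Q : ZMod m → ℤ → Prop} {k : ℤ}
    (h : ∀ z j, P z j → Q z (k + j)) {x : M} (hx : x ∈ monomialSpan e P) :
    (T k : CTau) • x ∈ monomialSpan e Q := by
  induction hx using Submodule.span_induction with
  | mem x hx =>
    obtain ⟨z, j, hz, rfl⟩ := hx
    rw [T_smul_T_smul]
    exact T_smul_mem_monomialSpan (h z j hz)
  | zero => rw [smul_zero]; exact zero_mem _
  | add x y _ _ hx hy => rw [smul_add]; exact add_mem hx hy
  | smul p x _ hx =>
    change (T k : CTau) • (p : CTau) • x ∈ _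
    rw [smul_comm]
    exact Submodule.smul_mem _ p hx

lemma below_orderFiltration (α : ℚ) :
    below (orderFiltration e a) α = monomialSpan e fun z j => a z - j < α := by
  refine le_antisymm ?_ ?_
  · exact iSup_le fun ⟨β, hβ⟩ => monomialSpan_mono fun z j h => h.trans_lt hβ
  · refine Submodule.span_le.2 ?_
    rintro _ ⟨z, j, hz, rfl⟩
    exact Submodule.mem_iSup_of_mem (p := fun β : {β : ℚ // β < α} => orderFiltration e a β)
      ⟨_, hz⟩ (T_smul_mem_monomialSpan le_rfl)

lemma orderFiltration_mono : Monotone (orderFiltration e a) := fun _ _ h =>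
  monomialSpan_mono fun _ _ h' => h'.trans h

lemma orderFiltration_exhaustive [NeZero m] (he : Submodule.span CTau (Set.range e) = ⊤) (x : M) :
    ∃ α, x ∈ orderFiltration e a α := by
  have add {x y : M} (hx : ∃ α, x ∈ orderFiltration e a α) (hy : ∃ α, y ∈ orderFiltration e a α) :
      ∃ α, x + y ∈ orderFiltration e a α := by
    obtain ⟨α, hx⟩ := hx
    obtain ⟨β, hy⟩ := hy
    exact ⟨max α β, add_mem (orderFiltration_mono (le_max_left α β) hx)
      (orderFiltration_mono (le_max_right α β) hy)⟩
  have hx : x ∈ Submodule.span CTau (Set.range e) := he ▸ Submodule.mem_top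
  induction hx using Submodule.span_induction with
  | mem x hx =>
    obtain ⟨z, rfl⟩ := hx
    refine ⟨a z - (0 : ℤ), ?_⟩
    have := T_smul_mem_monomialSpan (e := e) (P := fun y j => a y - j ≤ a z - (0 : ℤ))
      (z := z) (j := 0) le_rfl
    rwa [T_zero, one_smul] at this
  | zero => exact ⟨0, zero_mem _⟩
  | add x y _ _ hx hy => exact add hx hy
  | smul p x _ hx =>
    induction p using LaurentPolynomial.induction_on' with
    | add p q hp hq => rw [add_smul]; exact add hp hq
    | C_mul_T k c =>
      obtain ⟨α, hx⟩ := hx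
      refine ⟨α - k, ?_⟩
      rw [mul_smul]
      exact smul_mem_of_mem_tauPoly (C_mem_adjoin 1 c)
        (T_smul_mem_monomialSpan_of_mem (fun z j h => by push_cast; linarith) hx)

lemma orderFiltration_discrete [NeZero m] : ∃ N : ℕ, 0 < N ∧ ∀ α : ℚ,
    orderFiltration e a α = orderFiltration e a ((⌊(N : ℚ) * α⌋ : ℚ) / N) := by
  have hN : 0 < ∏ z, (a z).den := Finset.prod_pos fun z _ => (a z).den_pos
  refine ⟨∏ z, (a z).den, hN, fun α => ?_⟩
  have hN0 : (0 : ℚ) < (∏ z, (a z).den : ℕ) := by exact_mod_cast hN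
  rw [orderFiltration, orderFiltration]
  congr 1
  ext z j
  obtain ⟨d, hd⟩ := Finset.dvd_prod_of_mem (fun z => (a z).den) (Finset.mem_univ z)
  -- All orders are integers after multiplication by the product of the denominators, so only the
  -- floor of the bound matters.
  have h : ((∏ z, (a z).den : ℕ) : ℚ) * (a z - j) =
      (d * (a z).num - (∏ z, (a z).den : ℕ) * j : ℤ) := by
    rw [hd]
    have := Rat.den_mul_eq_num (a z)
    push_cast
    linear_combination (d : ℚ) * this
  rw [le_div_iff₀ hN0, mul_comm (a z - j), h, Int.cast_le, Int.le_floor, ← h,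
    mul_le_mul_iff_right₀ hN0]

lemma orderFiltration_fg [NeZero m] (α : ℚ) : (orderFiltration e a α).FG := by
  suffices h : orderFiltration e a α =
      Submodule.span tauPoly (Set.range fun z => (T ⌈a z - α⌉ : CTau) • e z) by
    rw [h]
    exact Submodule.fg_span (Set.finite_range _)
  refine le_antisymm ?_ ?_
  · refine Submodule.span_le.2 ?_
    rintro _ ⟨z, j, hz, rfl⟩
    have h : ⌈a z - α⌉ ≤ j := Int.ceil_le.2 (by linarith)
    obtain ⟨k, hk⟩ := Int.le.dest h
    rw [← hk, add_comm, ← T_smul_T_smul]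
    refine smul_mem_of_mem_tauPoly ?_ (Submodule.subset_span ⟨z, rfl⟩)
    have := C_mul_T_mem_adjoin 1 1 k
    rwa [map_one, one_mul, mul_one] at this
  · refine Submodule.span_le.2 ?_
    rintro _ ⟨z, rfl⟩
    exact T_smul_mem_monomialSpan (by linarith [Int.le_ceil (a z - α)])

lemma orderFiltration_shift (α : ℚ) (x : M) :
    x ∈ orderFiltration e a α ↔ (T 1 : CTau) • x ∈ orderFiltration e a (α - 1) := by
  refine ⟨T_smul_mem_monomialSpan_of_mem fun z j h => by push_cast; linarith, fun h => ?_⟩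
  have := T_smul_mem_monomialSpan_of_mem (k := -1) (Q := fun z j => a z - j ≤ α)
    (fun z j h => by push_cast; linarith) h
  rwa [T_smul_T_smul, neg_add_cancel, T_zero, one_smul] at this

variable [Module ℂ M] [IsScalarTower ℂ CTau M] {D : M →ₗ[ℂ] M} (hD : IsConnection D) {c : ℂ}
  (hE : ∀ z, euler D (e z) = -((a z : ℂ) • e z) - c • (T 1 : CTau) • e (z + 1))
include hD hE

lemma euler_T_smul_basis (z : ZMod m) (j : ℤ) : euler D ((T j : CTau) • e z) =
    ((j : ℂ) - a z) • (T j : CTau) • e z - c • (T (j + 1) : CTau) • e (z + 1) := by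
  rw [euler_T_smul hD, hE, smul_add, smul_sub, smul_neg, smul_comm_complex, smul_comm_complex,
    smul_comm_complex, T_smul_T_smul, sub_smul]
  abel

variable (ha : ∀ z, a (z + 1) ≤ a z + 1)
include ha

lemma euler_mem_orderFiltration (α : ℚ) {x : M} (hx : x ∈ orderFiltration e a α) :
    euler D x ∈ orderFiltration e a α := by
  induction hx using Submodule.span_induction with
  | mem x hx =>
    obtain ⟨z, j, hz, rfl⟩ := hx
    rw [euler_T_smul_basis hD hE, ← C_smul, ← C_smul]
    refine sub_mem (smul_mem_of_mem_tauPoly (C_mem_adjoin 1 _) (T_smul_mem_monomialSpan hz))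
      (smul_mem_of_mem_tauPoly (C_mem_adjoin 1 _) (T_smul_mem_monomialSpan ?_))
    have := ha z
    push_cast
    linarith
  | zero => rw [map_zero]; exact zero_mem _
  | add x y _ _ hx hy => rw [map_add]; exact add_mem hx hy
  | smul p x hx h =>
    change euler D ((p : CTau) • x) ∈ _
    rw [euler_smul hD]
    exact add_mem (smul_mem_of_mem_tauPoly (T_one_mul_dTau_mem_adjoin p.2) hx)
      (smul_mem_of_mem_tauPoly p.2 h)

/-- On monomials of order exactly α the diagonal part of τ∂_τ + α vanishes. The other term keeps the
order α only if a(z+1) = a(z) + 1. Thus each application either drops the order or raises the value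
of `a` by one; as `a` is bounded, the action on the graded piece is nilpotent. -/
lemma eulerShift_mem_monomialSpan (α : ℚ) (k : ℕ) {x : M}
    (hx : x ∈ monomialSpan e fun z j => a z - j < α ∨ a z - j = α ∧ k ≤ a z) :
    eulerShift (⇑D) α x ∈
      monomialSpan e fun z j => a z - j < α ∨ a z - j = α ∧ (k + 1 : ℕ) ≤ a z := by
  rw [eulerShift_eq, LinearMap.add_apply, Module.algebraMap_end_apply]
  induction hx using Submodule.span_induction with
  | mem x hx =>
    obtain ⟨z, j, hz, rfl⟩ := hx
    have h1 := ha z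
    rw [euler_T_smul_basis hD hE, sub_add_eq_add_sub, ← add_smul, ← C_smul, ← C_smul c]
    refine sub_mem ?_ (smul_mem_of_mem_tauPoly (C_mem_adjoin 1 _) (T_smul_mem_monomialSpan ?_))
    · rcases hz with hz | ⟨hz, -⟩
      · exact smul_mem_of_mem_tauPoly (C_mem_adjoin 1 _) (T_smul_mem_monomialSpan (Or.inl hz))
      · have : (j : ℂ) - a z + α = 0 := by
          rw [← hz]; push_cast; ring
        rw [this, map_zero, zero_smul]
        exact zero_mem _
    · rcases hz with hz | ⟨hz, hz'⟩
      · left; push_cast; linarith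
      · rcases h1.lt_or_eq with h | h
        · left; push_cast; linarith
        · right; push_cast; constructor <;> linarith
  | zero => rw [map_zero, smul_zero, add_zero]; exact zero_mem _
  | add x y _ _ hx hy => rw [map_add, smul_add, add_add_add_comm]; exact add_mem hx hy
  | smul p x hx h =>
    change euler D ((p : CTau) • x) + (α : ℂ) • (p : CTau) • x ∈ _
    rw [euler_smul hD, add_assoc, ← smul_comm_complex, ← smul_add]
    refine add_mem ?_ (smul_mem_of_mem_tauPoly p.2 h)
    refine adjoin_T_induction (P := fun p : CTau => (T 1 * dTau p) • x ∈ _) p.2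
      (fun p q hp hq => ?_) fun k' c => ?_
    · rw [map_add, mul_add, add_smul]
      exact add_mem hp hq
    · rw [← smul_eq_C_mul, map_smul, mul_smul_comm, T_one_mul_dTau_T, smul_smul, smul_eq_C_mul,
        mul_smul]
      -- The derivative term has the factor k', so it disappears for constants; a positive power of
      -- τ already lowers the order strictly.
      rcases k'.eq_zero_or_pos with rfl | hk
      · simp
      · refine smul_mem_of_mem_tauPoly (C_mem_adjoin 1 _)
          (T_smul_mem_monomialSpan_of_mem (fun z j h => Or.inl ?_) hx)
        have hk' : (1 : ℚ) ≤ k' := by exact_mod_cast hk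
        have : a z - j ≤ α := h.elim le_of_lt fun h => h.1.le
        push_cast
        linarith

lemma isVFiltration_orderFiltration [NeZero m] (he : Submodule.span CTau (Set.range e) = ⊤)
    (h0 : ∀ z, 0 ≤ a z) : IsVFiltration (⇑D) (orderFiltration e a) where
  mono := orderFiltration_mono
  exhaustive := orderFiltration_exhaustive he
  discrete := orderFiltration_discrete
  fg := orderFiltration_fg
  shift := orderFiltration_shift
  stable α x hx := euler_mem_orderFiltration hD hE ha α hx
  nilpotent α := by
    obtain ⟨B, hB⟩ := Finite.exists_le a
    obtain ⟨k, hk⟩ := exists_nat_gt B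
    refine ⟨k, fun x hx => ?_⟩
    have key (l : ℕ) : (eulerShift (⇑D) α)^[l] x ∈
        monomialSpan e fun z j => a z - j < α ∨ a z - j = α ∧ l ≤ a z := by
      induction l with
      | zero =>
        refine monomialSpan_mono (fun z j h => ?_) hx
        rw [Nat.cast_zero]
        exact h.lt_or_eq.imp_right fun h => ⟨h, h0 z⟩
      | succ l ih =>
        rw [Function.iterate_succ_apply']
        exact eulerShift_mem_monomialSpan hD hE ha α l ih
    rw [below_orderFiltration]
    refine monomialSpan_mono (fun z j h => ?_) (key k)
    exact h.resolve_right fun h => (hk.trans_le h.2).not_ge (hB z)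

end OrderFiltration

/-! ### Horizontal pairings -/

section Bar

lemma bar_C (c : ℂ) : bar (C c) = C c := eval₂_C ..

lemma bar_T_one : bar (T 1) = -T 1 := by
  have := eval₂_T_n (C : ℂ →+* CTau) negTau 1
  rwa [Nat.cast_one, pow_one] at this

lemma bar_T_neg_nat (m : ℕ) : bar (T (-(m : ℤ))) = (-1) ^ m * T (-(m : ℤ)) := by
  refine (eval₂_T_neg_n C negTau m).trans ?_
  have h : ((negTau⁻¹ : CTauˣ) : CTau) = -T (-1) := rfl
  rw [h, neg_pow, T_pow, mul_neg_one]

lemma bar_T_nat (m : ℕ) : bar (T (m : ℤ)) = (-1) ^ m * T (m : ℤ) := by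
  refine (eval₂_T_n C negTau m).trans ?_
  have h : ((negTau : CTauˣ) : CTau) = -T 1 := rfl
  rw [h, neg_pow, T_pow, mul_one]

lemma exists_bar_T (k : ℤ) : ∃ c : ℂ, bar (T k) = C c * T k := by
  obtain ⟨m, rfl | rfl⟩ := Int.eq_nat_or_neg k
  · exact ⟨(-1) ^ m, by rw [bar_T_nat]; simp⟩
  · exact ⟨(-1) ^ m, by rw [bar_T_neg_nat]; simp⟩

lemma bar_mem_adjoin {e : ℤ} {p : CTau} (hp : p ∈ Algebra.adjoin ℂ {(T e : CTau)}) :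
    bar p ∈ Algebra.adjoin ℂ {(T e : CTau)} := by
  refine adjoin_T_induction (P := fun p => bar p ∈ _) hp (fun p q hp hq => ?_) fun m c => ?_
  · rw [map_add]; exact add_mem hp hq
  · obtain ⟨d, hd⟩ := exists_bar_T (m * e)
    rw [map_mul, hd, bar_C]
    exact mul_mem (C_mem_adjoin e c) (C_mul_T_mem_adjoin e d m)

lemma bar_bar (p : CTau) : bar (bar p) = p := by
  induction p using LaurentPolynomial.induction_on' with
  | add p q hp hq => rw [map_add, map_add, hp, hq]
  | C_mul_T k c =>
    rw [map_mul, map_mul, bar_C, bar_C]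
    congr 1
    obtain ⟨m, rfl | rfl⟩ := Int.eq_nat_or_neg k
    · rw [bar_T_nat, map_mul, bar_T_nat, ← mul_assoc, map_pow, map_neg, map_one, ← mul_pow]
      simp
    · rw [bar_T_neg_nat, map_mul, bar_T_neg_nat, ← mul_assoc, map_pow, map_neg, map_one, ← mul_pow]
      simp

lemma T_one_mul_dTau_bar (p : CTau) : T 1 * dTau (bar p) = bar (T 1 * dTau p) := by
  induction p using LaurentPolynomial.induction_on' with
  | add p q hp hq => simp only [map_add, mul_add, hp, hq]
  | C_mul_T k c =>
    obtain ⟨d, hd⟩ := exists_bar_T k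
    rw [map_mul, hd, bar_C, ← smul_eq_C_mul, ← smul_eq_C_mul, ← smul_eq_C_mul, map_smul, map_smul,
      map_smul, mul_smul_comm, mul_smul_comm, mul_smul_comm, T_one_mul_dTau_T, smul_eq_C_mul,
      smul_eq_C_mul, smul_eq_C_mul, smul_eq_C_mul, map_mul, map_mul, bar_C, bar_C, hd]
    ring

lemma coeff_T_mul_eq_zero {k j : ℤ} (hj : k < j) {p : CTau} (hp : p ∈ thetaPoly) :
    (T k * p).coeff j = 0 := by
  refine adjoin_T_induction (P := fun p : CTau => (T k * p).coeff j = 0) hp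
    (fun p q hp hq => ?_) fun m c => ?_
  · rw [mul_add, AddMonoidAlgebra.coeff_add, Finsupp.add_apply, hp, hq, add_zero]
  · rw [mul_left_comm, ← T_add, ← single_eq_C_mul_T, AddMonoidAlgebra.coeff_single,
      Finsupp.single_eq_of_ne (by lia)]

lemma coeff_T_one_mul_dTau (p : CTau) (j : ℤ) : (T 1 * dTau p).coeff j = j * p.coeff j := by
  induction p using LaurentPolynomial.induction_on' with
  | add p q hp hq =>
    rw [map_add, mul_add, AddMonoidAlgebra.coeff_add, Finsupp.add_apply, hp, hq,
      AddMonoidAlgebra.coeff_add, Finsupp.add_apply, mul_add]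
  | C_mul_T k c =>
    rw [← smul_eq_C_mul, map_smul, mul_smul_comm, T_one_mul_dTau_T, smul_smul, smul_eq_C_mul,
      smul_eq_C_mul, ← single_eq_C_mul_T, ← single_eq_C_mul_T, AddMonoidAlgebra.coeff_single,
      AddMonoidAlgebra.coeff_single, Finsupp.single_apply, Finsupp.single_apply]
    split_ifs with h
    · rw [h, mul_comm]
    · rw [mul_zero]

lemma coeff_T_one_mul (p : CTau) (j : ℤ) : (T 1 * p).coeff j = p.coeff (j - 1) := by
  induction p using LaurentPolynomial.induction_on' with
  | add p q hp hq =>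
    rw [mul_add, AddMonoidAlgebra.coeff_add, Finsupp.add_apply, hp, hq,
      AddMonoidAlgebra.coeff_add, Finsupp.add_apply]
  | C_mul_T k c =>
    rw [mul_left_comm, ← T_add, ← single_eq_C_mul_T, ← single_eq_C_mul_T,
      AddMonoidAlgebra.coeff_single, AddMonoidAlgebra.coeff_single, Finsupp.single_apply,
      Finsupp.single_apply]
    congr 1
    exact propext ⟨fun h => by lia, fun h => by lia⟩

lemma coeff_smul_apply (c : ℂ) (p : CTau) (j : ℤ) : (c • p).coeff j = c * p.coeff j := by
  rw [AddMonoidAlgebra.coeff_smul, Finsupp.smul_apply, smul_eq_mul]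

end Bar

/-! ### Horizontality as a Leibniz rule for τ∂_τ, and its verification on generators -/

section Horizontal

variable {M : Type*} [AddCommGroup M] [Module CTau M]

lemma smul_pairing (S : M →ₗ[CTau] M →ₛₗ[bar] CTau) (p : CTau) (x y : M) :
    S (p • x) y = p * S x y := by
  rw [S.map_smul]; rfl

lemma pairing_smul (S : M →ₗ[CTau] M →ₛₗ[bar] CTau) (p : CTau) (x y : M) :
    S x (p • y) = bar p * S x y :=
  (S x).map_smulₛₗ p y

variable [Module ℂ M] [IsScalarTower ℂ CTau M] {D : M →ₗ[ℂ] M}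

lemma map_complex_smul (S : M →ₗ[CTau] M →ₛₗ[bar] CTau) (c : ℂ) (x y : M) :
    S x (c • y) = c • S x y := by
  rw [← C_smul, pairing_smul, bar_C, smul_eq_C_mul]

lemma complex_smul_map (S : M →ₗ[CTau] M →ₛₗ[bar] CTau) (c : ℂ) (x y : M) :
    S (c • x) y = c • S x y := by
  rw [← C_smul, smul_pairing, smul_eq_C_mul]

/-- Multiply by τ: passing it into the second argument changes its sign, which turns the difference
into a sum. -/
lemma horizontal_iff (S : M →ₗ[CTau] M →ₛₗ[bar] CTau) (x y : M) :
    dTau (S x y) = S (D x) y - S x (D y) ↔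
      T 1 * dTau (S x y) = S (euler D x) y + S x (euler D y) := by
  rw [euler_apply, euler_apply, smul_pairing, pairing_smul, bar_T_one, neg_mul,
    ← sub_eq_add_neg, ← mul_sub]
  exact ((isUnit_T 1).mul_right_inj).symm

variable (hD : IsConnection D)
include hD

lemma horizontal_of_span {m : ℕ} {e : ZMod m → M} (he : Submodule.span CTau (Set.range e) = ⊤)
    (S : M →ₗ[CTau] M →ₛₗ[bar] CTau)
    (h : ∀ z y, T 1 * dTau (S (e z) (e y)) = S (euler D (e z)) (e y) + S (e z) (euler D (e y)))
    (x y : M) : dTau (S x y) = S (D x) y - S x (D y) := by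
  rw [horizontal_iff]
  have hx : x ∈ Submodule.span CTau (Set.range e) := he ▸ Submodule.mem_top
  have hy : y ∈ Submodule.span CTau (Set.range e) := he ▸ Submodule.mem_top
  induction hx using Submodule.span_induction with
  | mem x hx =>
    obtain ⟨z, rfl⟩ := hx
    induction hy using Submodule.span_induction with
    | mem y hy => obtain ⟨y, rfl⟩ := hy; exact h z y
    | zero => simp
    | add x y _ _ hx hy => simp only [map_add, mul_add, hx, hy]; ring
    | smul p x _ hx =>
      rw [euler_smul hD, map_add, pairing_smul, pairing_smul, pairing_smul, pairing_smul, dTau_mul]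
      linear_combination bar p * hx + S (e z) x * T_one_mul_dTau_bar p
  | zero => simp
  | add x y _ _ hx hy => simp only [map_add, mul_add, LinearMap.add_apply, hx, hy]; ring
  | smul p x _ hx =>
    rw [euler_smul hD, map_add, LinearMap.add_apply, smul_pairing, smul_pairing, smul_pairing,
      smul_pairing, dTau_mul]
    linear_combination p * hx

end Horizontal

/-- The recursion satisfied by the coefficients of a horizontal pairing, with vanishing coefficients
in degrees larger than `-n`, has a one-dimensional space of finitely supported solutions. -/
lemma coefficients_eq_of_recursion {m : ℕ} [NeZero m] {a : ZMod m → ℚ} {c : ℂ} (hc : c ≠ 0)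
    (hadd : ∀ z y : ZMod m, z + y = n → a z + a y = n) (ha : ∀ z, a (z + 1) ≤ a z + 1)
    (h0 : a 0 = 0) (hmax : ∀ z, n ≤ a z → z = n) {F : ZMod m → ZMod m → ℤ → ℂ}
    (hzero : ∀ z y (j : ℤ), -n < j → F z y j = 0) {J : ℤ} (hJ : ∀ z y, ∀ j < J, F z y j = 0)
    (hrec : ∀ z y (j : ℤ), ((j : ℂ) + (a z + a y : ℚ)) * F z y j =
      c * (F z (y + 1) (j - 1) - F (z + 1) y (j - 1))) (z y : ZMod m) (j : ℤ) :
    F z y j = if z + y = n ∧ j = -n then F 0 n (-n) else 0 := by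
  -- Upward induction on the degree, starting below the support. The condition passes to the terms
  -- of degree j - 1 because `a` grows by at most one, and it makes the factor j + a(z) + a(y)
  -- negative.
  have hord (s : ℕ) : ∀ z y, ∀ j : ℤ, j < J + s → a z + a y < -j → F z y j = 0 := by
    induction s with
    | zero => exact fun z y j hj _ => hJ z y j (by simpa using hj)
    | succ s ih =>
      intro z y j hj h
      have h1 := ha z
      have h2 := ha y
      have h3 := hrec z y j
      rw [ih z (y + 1) (j - 1) (by push_cast at hj; lia) (by push_cast; linarith),
        ih (z + 1) y (j - 1) (by push_cast at hj; lia) (by push_cast; linarith), sub_self,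
        mul_zero] at h3
      refine (mul_eq_zero.1 h3).resolve_left ?_
      have : (j : ℚ) + (a z + a y) ≠ 0 := by linarith
      exact_mod_cast this
  have hord' {z y : ZMod m} {j : ℤ} (h : a z + a y < -j) : F z y j = 0 :=
    hord (j - J + 1).toNat z y j (by lia) h
  -- When the left side of the recursion vanishes in degree j + 1, one unit can be moved between the
  -- two indices in degree j, so only z + y matters.
  have hshift {j : ℤ} (h : ∀ z y, (((j + 1 : ℤ) : ℂ) + (a z + a y : ℚ)) * F z y (j + 1) = 0)
      (z y : ZMod m) : F z y j = F 0 (z + y) j := by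
    obtain ⟨k, rfl⟩ := ZMod.natCast_zmod_surjective z
    induction k generalizing y with
    | zero => rw [Nat.cast_zero, zero_add]
    | succ k ih =>
      have h1 := hrec k y (j + 1)
      rw [h, add_sub_cancel_right] at h1
      have h2 := sub_eq_zero.1 ((mul_eq_zero.1 h1.symm).resolve_left hc)
      rw [Nat.cast_succ, ← h2, ih]
      congr 1
      ring
  -- After shifting to the indices 0 and z + y, the order bound applies: a(z+y) < n unless z + y =
  -- n, and a(n) = n is still less than -j when j < -n.
  have hvanish {z y : ZMod m} {j : ℤ} (hj : j ≤ -n)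
      (h : ∀ z y, (((j + 1 : ℤ) : ℂ) + (a z + a y : ℚ)) * F z y (j + 1) = 0)
      (hzy : z + y ≠ (n : ZMod m) ∨ j < -n) : F z y j = 0 := by
    rw [hshift h]
    refine hord' ?_
    rw [h0, zero_add]
    have hj' : (j : ℚ) ≤ -n := by exact_mod_cast hj
    rcases hzy with hzy | hzy
    · have := lt_of_not_ge (mt (hmax (z + y)) hzy)
      linarith
    · have h1 : (j : ℚ) < -n := by exact_mod_cast hzy
      have h2 : a (z + y) ≤ n := by
        by_contra! h2
        have h3 := hmax _ h2.le
        have h4 := hadd 0 (z + y) (by rw [h3, zero_add])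
        linarith
      linarith
  have hfirst : ∀ z y, (((-n + 1 : ℤ) : ℂ) + (a z + a y : ℚ)) * F z y (-n + 1) = 0 :=
    fun z y => by rw [hzero z y _ (by lia), mul_zero]
  have htop (z y : ZMod m) : F z y (-n) = if z + y = n then F 0 n (-n) else 0 := by
    split_ifs with h
    · rw [hshift hfirst, h]
    · exact hvanish le_rfl hfirst (Or.inl h)
  -- Downward induction. In degree -n the values may be nonzero for z + y = n, but there the factor
  -- -n + a(z) + a(y) is zero.
  have hrest (s : ℕ) : ∀ z y, F z y (-n - 1 - s) = 0 := by
    induction s with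
    | zero =>
      refine fun z y => hvanish (by lia) (fun z y => ?_) (Or.inr (by lia))
      rw [Nat.cast_zero, sub_zero, sub_add_cancel, htop]
      split_ifs with h
      · rw [hadd z y h]; simp
      · rw [mul_zero]
    | succ s ih =>
      refine fun z y => hvanish (by lia) (fun z y => ?_) (Or.inr (by lia))
      rw [show (-n - 1 - (s + 1 : ℕ) + 1 : ℤ) = -n - 1 - s by push_cast; ring, ih, mul_zero]
  by_cases h : j = -n
  · rw [h, htop]
    simp only [and_true]
  · rw [if_neg fun h' => h h'.2]
    rcases lt_or_gt_of_ne h with h | h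
    · have := hrest (-n - 1 - j).toNat z y
      rwa [show (-n - 1 - (-n - 1 - j).toNat : ℤ) = j by lia] at this
    · exact hzero z y j h

/-! ### The pairing defined by a basis -/

section BasisPairing

variable {M : Type*} [AddCommGroup M] [Module CTau M] {m : ℕ} [NeZero m]

/-- The pairing with `S(eₖ, eₗ) = τ⁻ⁿ` if `k + l = n` modulo `m`, and `0` otherwise. -/
def basisPairing (n : ℕ) (e : Module.Basis (ZMod m) CTau M) : M →ₗ[CTau] M →ₛₗ[bar] CTau :=
  LinearMap.mk₂'ₛₗ (RingHom.id CTau) bar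
    (fun x y => T (-(n : ℤ)) * ∑ z, e.repr x z * bar (e.repr y (n - z)))
    (fun x x' y => by
      simp only [map_add, Finsupp.add_apply, add_mul, Finset.sum_add_distrib, mul_add])
    (fun p x y => by
      simp only [map_smul, Finsupp.smul_apply, smul_eq_mul, RingHom.id_apply, mul_assoc,
        ← Finset.mul_sum]
      ring)
    (fun x y y' => by
      simp only [map_add, Finsupp.add_apply, Finset.sum_add_distrib, mul_add])
    (fun p x y => by
      simp only [map_smul, Finsupp.smul_apply, smul_eq_mul, map_mul, mul_left_comm _ (bar p),
        ← Finset.mul_sum])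

variable (e : Module.Basis (ZMod m) CTau M)

lemma basisPairing_apply (x y : M) : basisPairing n e x y =
    T (-(n : ℤ)) * ∑ z, e.repr x z * bar (e.repr y (n - z)) := rfl

lemma basisPairing_basis_left (z : ZMod m) (y : M) :
    basisPairing n e (e z) y = T (-(n : ℤ)) * bar (e.repr y (n - z)) := by
  rw [basisPairing_apply, Finset.sum_eq_single z]
  · simp
  · intro z' _ h
    rw [e.repr_self, Finsupp.single_eq_of_ne h, zero_mul]
  · simp

lemma basisPairing_basis (z y : ZMod m) :
    basisPairing n e (e z) (e y) = if z + y = n then T (-(n : ℤ)) else 0 := by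
  rw [basisPairing_basis_left, e.repr_self, Finsupp.single_apply]
  have : y = n - z ↔ z + y = n := by rw [eq_sub_iff_add_eq, add_comm]
  simp only [this]
  split_ifs <;> simp

lemma basisPairing_symm (x y : M) :
    basisPairing n e y x = (-1) ^ n * bar (basisPairing n e x y) := by
  rw [basisPairing_apply, basisPairing_apply, map_mul, map_sum, bar_T_neg_nat, ← mul_assoc,
    ← mul_assoc, ← mul_pow, neg_one_mul, neg_neg, one_pow, one_mul]
  congr 1
  refine Fintype.sum_equiv (Equiv.subLeft (n : ZMod m)) _ _ fun z => ?_
  rw [map_mul, bar_bar, Equiv.subLeft_apply, sub_sub_cancel, mul_comm]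

lemma basisPairing_mem_tauPoly {P Q : ZMod m → ℤ → Prop}
    (h : ∀ z j y k, P z j → Q y k → z + y = n → n ≤ j + k) {x y : M}
    (hx : x ∈ monomialSpan e P) (hy : y ∈ monomialSpan e Q) : basisPairing n e x y ∈ tauPoly := by
  induction hx using Submodule.span_induction with
  | mem x hx =>
    obtain ⟨z, j, hz, rfl⟩ := hx
    induction hy using Submodule.span_induction with
    | mem y hy =>
      obtain ⟨y, k, hy, rfl⟩ := hy
      obtain ⟨c, hc⟩ := exists_bar_T k
      rw [smul_pairing, pairing_smul, basisPairing_basis, hc]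
      split_ifs with hzy
      · obtain ⟨i, hi⟩ := Int.le.dest (h z j y k hz hy hzy)
        have : (T j : CTau) * (C c * T k * (T (-(n : ℤ)) : CTau)) = C c * T (i * 1) := by
          rw [mul_assoc, mul_left_comm, ← T_add, ← T_add]
          congr 2
          lia
        rw [this]
        exact C_mul_T_mem_adjoin 1 c i
      · rw [mul_zero, mul_zero]; exact zero_mem _
    | zero => rw [map_zero]; exact zero_mem _
    | add x y _ _ hx hy => rw [map_add]; exact add_mem hx hy
    | smul p x _ hx =>
      change basisPairing n e _ ((p : CTau) • x) ∈ _
      rw [pairing_smul]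
      exact mul_mem (bar_mem_adjoin p.2) hx
  | zero => rw [map_zero, LinearMap.zero_apply]; exact zero_mem _
  | add x y _ _ hx hy => rw [map_add, LinearMap.add_apply]; exact add_mem hx hy
  | smul p x _ hx =>
    change basisPairing n e ((p : CTau) • x) _ ∈ _
    rw [smul_pairing]
    exact mul_mem p.2 hx

lemma basisPairing_mem_thetaPoly {x y : M} (hx : x ∈ Submodule.span thetaPoly (Set.range e))
    (hy : y ∈ Submodule.span thetaPoly (Set.range e)) :
    ∃ p ∈ thetaPoly, basisPairing n e x y = T (-(n : ℤ)) * p := by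
  have repr_mem {x : M} (hx : x ∈ Submodule.span thetaPoly (Set.range e)) (z : ZMod m) :
      e.repr x z ∈ thetaPoly := by
    induction hx using Submodule.span_induction with
    | mem x hx =>
      obtain ⟨y, rfl⟩ := hx
      rw [e.repr_self, Finsupp.single_apply]
      split_ifs
      exacts [one_mem _, zero_mem _]
    | zero => rw [map_zero]; exact zero_mem _
    | add x y _ _ hx hy => rw [map_add]; exact add_mem hx hy
    | smul p x _ hx =>
      change e.repr ((p : CTau) • x) z ∈ _
      rw [map_smul]
      exact mul_mem p.2 hx
  exact ⟨_, sum_mem fun z _ => mul_mem (repr_mem hx z) (bar_mem_adjoin (repr_mem hy _)), rfl⟩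

/-- The coordinates of the second argument, recovered from the pairing. -/
lemma repr_eq_bar (y : M) (z : ZMod m) :
    e.repr y z = bar (T n * basisPairing n e (e (n - z)) y) := by
  rw [basisPairing_basis_left, ← mul_assoc, ← T_add, add_neg_cancel, T_zero, one_mul, bar_bar,
    sub_sub_cancel]

lemma bijective_basisPairing : Function.Bijective (basisPairing n e) := by
  constructor
  · rw [injective_iff_map_eq_zero]
    intro x hx
    refine e.repr.injective (Finsupp.ext fun z => ?_)
    rw [repr_eq_bar (n := n), basisPairing_symm, hx]
    simp
  · intro φ
    -- The dual basis of the eₖ for this pairing consists of the τⁿ eₙ₋ₖ.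
    refine ⟨∑ z, (T n * φ (e (n - z))) • e z, ?_⟩
    have h : ∀ y, basisPairing n e (∑ z, (T n * φ (e (n - z))) • e z) (e y) = φ (e y) := by
      intro y
      rw [map_sum, LinearMap.sum_apply, Finset.sum_eq_single (n - y)]
      · rw [map_smul, LinearMap.smul_apply, basisPairing_basis, if_pos (sub_add_cancel _ _),
          sub_sub_cancel, smul_eq_mul, mul_right_comm, ← T_add, add_neg_cancel, T_zero, one_mul]
      · intro z _ hz
        rw [map_smul, LinearMap.smul_apply, basisPairing_basis,
          if_neg fun h => hz (eq_sub_of_add_eq h), smul_zero]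
      · simp
    exact e.ext h

lemma bijective_basisPairing_flip : Function.Bijective (basisPairing n e).flip := by
  constructor
  · rw [injective_iff_map_eq_zero]
    intro y hy
    refine e.repr.injective (Finsupp.ext fun z => ?_)
    rw [repr_eq_bar (n := n), ← LinearMap.flip_apply, hy]
    simp
  · intro φ
    refine ⟨∑ z, bar (T n * φ (e (n - z))) • e z, e.ext fun y => ?_⟩
    rw [LinearMap.flip_apply, basisPairing_basis_left, map_sum, Finsupp.finsetSum_apply,
      Finset.sum_eq_single (n - y)]
    · rw [map_smul, e.repr_self, Finsupp.smul_apply, Finsupp.single_eq_same, smul_eq_mul, mul_one,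
        bar_bar, sub_sub_cancel, ← mul_assoc, ← T_add, neg_add_cancel, T_zero, one_mul]
    · intro z _ hz
      rw [map_smul, e.repr_self, Finsupp.smul_apply, Finsupp.single_eq_of_ne hz.symm, smul_zero]
    · simp

lemma nondegenerate_basisPairing : (basisPairing n e).Nondegenerate := by
  constructor
  · intro x hx
    exact (injective_iff_map_eq_zero _).1 (bijective_basisPairing (n := n) e).1 x
      (LinearMap.ext hx)
  · intro y hy
    exact (injective_iff_map_eq_zero _).1 (bijective_basisPairing_flip (n := n) e).1 y
      (LinearMap.ext hy)

variable [Module ℂ M] [IsScalarTower ℂ CTau M] {D : M →ₗ[ℂ] M} (hD : IsConnection D) {c : ℂ}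
  {a : ZMod m → ℚ} (hE : ∀ z, euler D (e z) = -((a z : ℂ) • e z) - c • (T 1 : CTau) • e (z + 1))
  (hadd : ∀ z y : ZMod m, z + y = n → a z + a y = n)
include hE

omit [NeZero m] in
lemma T_one_mul_dTau_pairing (S : M →ₗ[CTau] M →ₛₗ[bar] CTau) (z y : ZMod m) :
    S (euler D (e z)) (e y) + S (e z) (euler D (e y)) = -(((a z + a y : ℚ) : ℂ) • S (e z) (e y)) +
      c • (T 1 * (S (e z) (e (y + 1)) - S (e (z + 1)) (e y))) := by
  rw [hE, hE, map_sub, map_sub, map_neg, map_neg, LinearMap.sub_apply, LinearMap.neg_apply,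
    complex_smul_map, map_complex_smul, map_complex_smul, complex_smul_map, smul_pairing,
    pairing_smul, bar_T_one]
  push_cast
  simp only [smul_eq_C_mul, map_add]
  ring

include hadd hD in
lemma horizontal_basisPairing (x y : M) :
    dTau (basisPairing n e x y) = basisPairing n e (D x) y - basisPairing n e x (D y) := by
  refine horizontal_of_span hD e.span_eq _ (fun z y => ?_) x y
  rw [T_one_mul_dTau_pairing e hE, basisPairing_basis, basisPairing_basis, basisPairing_basis,
    show z + (y + 1) = z + 1 + y by ring, sub_self, mul_zero, smul_zero, add_zero]
  split_ifs with h
  · rw [T_one_mul_dTau_T, hadd z y h]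
    simp
  · simp

variable (hc : c ≠ 0) (ha : ∀ z, a (z + 1) ≤ a z + 1) (h0 : a 0 = 0)
  (hmax : ∀ z, n ≤ a z → z = n)
include hadd hc ha h0 hmax

/-- A horizontal pairing whose values on the basis belong to `θⁿ ℂ[θ]` is a multiple of the
standard one. -/
lemma eq_smul_basisPairing (S : M →ₗ[CTau] M →ₛₗ[bar] CTau)
    (hS : ∀ x y, dTau (S x y) = S (D x) y - S x (D y))
    (hpole : ∀ z y, ∃ p ∈ thetaPoly, S (e z) (e y) = T (-(n : ℤ)) * p) :
    ∃ d : ℂ, ∀ x y, S x y = C d * basisPairing n e x y := by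
  -- Finitely many Laurent polynomials have a common lower bound for their degrees.
  have hlow : ∃ J : ℤ, ∀ z y, ∀ j < J, (S (e z) (e y)).coeff j = 0 := by
    have h1 (q : ZMod m × ZMod m) : ∃ J : ℤ, ∀ j < J, (S (e q.1) (e q.2)).coeff j = 0 := by
      obtain ⟨J, hJ⟩ := (S (e q.1) (e q.2)).coeff.support.bddBelow
      refine ⟨J, fun j hj => ?_⟩
      by_contra h
      exact (hJ (Finsupp.mem_support_iff.2 h)).not_gt hj
    choose J hJ using h1
    obtain ⟨K, hK⟩ := (Set.finite_range J).bddBelow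
    exact ⟨K, fun z y j hj => hJ (z, y) j (lt_of_lt_of_le hj (hK ⟨_, rfl⟩))⟩
  obtain ⟨J, hJ⟩ := hlow
  have key := coefficients_eq_of_recursion (F := fun z y j => (S (e z) (e y)).coeff j)
    hc hadd ha h0 hmax (fun z y j hj => by
      obtain ⟨p, hp, h⟩ := hpole z y
      simp only [h]
      exact coeff_T_mul_eq_zero hj hp) hJ (fun z y j => by
      have h := (horizontal_iff S (e z) (e y)).1 (hS _ _)
      rw [T_one_mul_dTau_pairing e hE] at h
      have h1 := congrArg (fun p : CTau => p.coeff j) h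
      simp only [coeff_T_one_mul_dTau] at h1
      simp only [AddMonoidAlgebra.coeff_add, AddMonoidAlgebra.coeff_neg, Finsupp.add_apply,
        Finsupp.neg_apply, coeff_smul_apply, coeff_T_one_mul, AddMonoidAlgebra.coeff_sub,
        Finsupp.sub_apply] at h1
      linear_combination h1)
  set d := (S (e 0) (e n)).coeff (-n)
  refine ⟨d, ?_⟩
  have hbasis (z y) : S (e z) (e y) = C d * basisPairing n e (e z) (e y) := by
    refine LaurentPolynomial.ext fun j => ?_
    rw [key z y j, basisPairing_basis]
    by_cases h : z + y = n
    · rw [if_pos h, ← single_eq_C_mul_T, AddMonoidAlgebra.coeff_single, Finsupp.single_apply]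
      simp only [h, true_and, eq_comm]
    · rw [if_neg h, if_neg fun h' => h h'.1, mul_zero]
      simp
  have hmap : S = C d • basisPairing n e :=
    e.ext fun z => e.ext fun y => hbasis z y
  intro x y
  conv_lhs => rw [hmap]
  rfl

end BasisPairing

/-! ### The duality on the Gauss-Manin system -/

section Duality

variable {w : Fin (n + 1) → ℕ} (b : Module.Basis (Fin n) ℤ (weightLattice w))
  (hw : ∀ i, 0 < w i) (hgcd : Finset.univ.gcd w = 1) [NeZero (∑ i, w i)]
include hw hgcd

lemma euler_omegaBasis (z : ZMod (∑ i, w i)) :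
    euler (connection (weightPoly b)) (omegaBasis b hw hgcd z) =
      -((alpha w z : ℂ) • omegaBasis b hw hgcd z) -
        ((∑ i, w i : ℕ) : ℂ) • (T 1 : CTau) • omegaBasis b hw hgcd (z + 1) := by
  rw [omegaBasis_apply, omegaBasis_apply]
  exact euler_cyclicOmega b hw z

lemma omegaBasis_natCast (k : ℕ) : omegaBasis b hw hgcd k = omega b k := by
  rw [omegaBasis_apply, cyclicOmega_natCast b hw]

lemma omegaBasis_mem_brieskorn (z : ZMod (∑ i, w i)) :
    omegaBasis b hw hgcd z ∈ brieskorn (weightPoly b) := by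
  rw [omegaBasis_apply]
  exact Submodule.subset_span ⟨_, rfl⟩

lemma isVFiltration_omegaBasis : IsVFiltration (connection (weightPoly b))
    (orderFiltration (omegaBasis b hw hgcd) (alpha w)) :=
  isVFiltration_orderFiltration (isConnection_connection _) (euler_omegaBasis b hw hgcd)
    (alpha_add_one_le hw) (omegaBasis b hw hgcd).span_eq fun _ => spectralNumber_nonneg hw _

/-- Uniqueness of the filtration replaces `V` by the order filtration of the ω_k. The forward
direction then uses horizontality and the pole bound on the basis, with nondegeneracy excluding the
zero multiple. -/
theorem isDuality_iff {V : ℚ → Submodule tauPoly (System (weightPoly b))}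
    (hV : IsVFiltration (connection (weightPoly b)) V) (S : Pairing (weightPoly b)) :
    IsDuality (weightPoly b) V S ↔
      ∃ c : ℂ, c ≠ 0 ∧ ∀ x y, S x y = C c * basisPairing n (omegaBasis b hw hgcd) x y := by
  obtain rfl := hV.unique (isVFiltration_omegaBasis b hw hgcd)
  have hadd := fun z y : ZMod (∑ i, w i) => alpha_add_alpha hw (y := z) (z := y)
  constructor
  · intro hS
    obtain ⟨c, hc⟩ := eq_smul_basisPairing (omegaBasis b hw hgcd) (euler_omegaBasis b hw hgcd) hadd
      (sum_cast_ne_zero hw) (alpha_add_one_le hw) alpha_zero (fun z => eq_of_le_alpha hw hgcd) S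
      hS.horizontal fun z y => hS.map_brieskorn _ (omegaBasis_mem_brieskorn b hw hgcd z) _
        (omegaBasis_mem_brieskorn b hw hgcd y)
    refine ⟨c, ?_, hc⟩
    rintro rfl
    refine (omegaBasis b hw hgcd).ne_zero 0 (hS.nondegenerate.1 _ fun y => ?_)
    rw [hc, map_zero, zero_mul]
  · rintro ⟨c, hc, hS⟩
    have hd : dTau (C c) = 0 := by
      rw [← mul_one (C c), ← T_zero, ← smul_eq_C_mul, map_smul, dTau_T]
      simp
    refine ⟨⟨fun x hx => ?_, fun y hy => ?_⟩, fun x y => ?_, fun x hx y hy => ?_,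
      fun x hx y hy => ?_⟩
    · refine (nondegenerate_basisPairing (n := n) (omegaBasis b hw hgcd)).1 x fun y => ?_
      have := hx y
      rw [hS, ← smul_eq_C_mul] at this
      exact (smul_eq_zero.1 this).resolve_left hc
    · refine (nondegenerate_basisPairing (n := n) (omegaBasis b hw hgcd)).2 y fun x => ?_
      have := hy x
      rw [hS, ← smul_eq_C_mul] at this
      exact (smul_eq_zero.1 this).resolve_left hc
    · rw [hS, hS, hS, dTau_mul, hd, zero_mul, zero_add, ← mul_sub, horizontal_basisPairing
        (omegaBasis b hw hgcd) (isConnection_connection _) (euler_omegaBasis b hw hgcd) hadd]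
    · rw [hS]
      refine mul_mem (C_mem_adjoin 1 c) ?_
      rw [below_orderFiltration] at hy
      refine basisPairing_mem_tauPoly _ (fun z j y k hz hy hzy => ?_) hx hy
      have h := hadd z y hzy
      -- The orders satisfy α(z) ≤ j and α(y) < k + 1, and the spectral numbers add up to n.
      -- Integrality then gives n ≤ j + k, so no negative power of τ occurs.
      have : (n : ℚ) < j + k + 1 := by linarith
      have : (n : ℤ) < j + k + 1 := by exact_mod_cast this
      lia
    · have hspan {x} (hx : x ∈ brieskorn (weightPoly b)) :
          x ∈ Submodule.span thetaPoly (Set.range (omegaBasis b hw hgcd)) := by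
        have e : ⇑(omegaBasis b hw hgcd) = cyclicOmega b :=
          funext fun z => omegaBasis_apply b hw hgcd z
        rw [e]
        exact brieskorn_le_span b hw hgcd hx
      obtain ⟨p, hp, h⟩ := basisPairing_mem_thetaPoly (n := n) (omegaBasis b hw hgcd)
        (hspan hx) (hspan hy)
      exact ⟨C c * p, mul_mem (C_mem_adjoin (-1) c) hp, by rw [hS, h, mul_left_comm]⟩

end Duality

/-! ### From indices modulo μ to integers, and the final assembly -/

lemma natCast_add_eq_iff {m k l : ℕ} (hn : n < m) (hk : k < m) (hl : l < m) :
    (k : ZMod m) + l = n ↔ (k ≤ n ∧ k + l = n) ∨ (n + 1 ≤ k ∧ k + l = m + n) := by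
  rw [← Nat.cast_add, ZMod.natCast_eq_natCast_iff]
  constructor
  · intro h
    rcases lt_or_ge (k + l) m with h1 | h1
    · have := h.eq_of_lt_of_lt h1 hn
      lia
    · have h2 : k + l - m ≡ n [MOD m] := by
        have : k + l - m + m ≡ n [MOD m] := by rwa [Nat.sub_add_cancel h1]
        simpa using this
      have := h2.eq_of_lt_of_lt (by lia) hn
      lia
  · rintro (⟨-, h⟩ | ⟨-, h⟩)
    · rw [h]
    · rw [h]
      simp

lemma bijective_smul_of_bijective {A B : Type*} [AddCommGroup A] [AddCommGroup B] [Module CTau B]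
    {c : ℂ} (hc : c ≠ 0) {f g : A → B} (hf : Function.Bijective f)
    (h : ∀ x, g x = (C c : CTau) • f x) : Function.Bijective g := by
  have hu : IsUnit (C c : CTau) := (isUnit_iff_ne_zero.2 hc).map C
  have : g = (fun x => (C c : CTau) • x) ∘ f := funext h
  rw [this]
  exact (MulAction.bijective hu.unit).comp hf

end GaussManin

end

open GaussManin
theorem mainTheorem5 (n : ℕ) (hn : 2 ≤ n) (w : Fin (n + 1) → ℕ) (hw : ∀ i, 0 < w i)
    (hgcd : Finset.univ.gcd w = 1) (b : Module.Basis (Fin n) ℤ (weightLattice w))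
    (μ : ℕ) (hμ : μ = ∑ i, w i) :
    (∃! V : ℚ → Submodule tauPoly (System (weightPoly b)),
      IsVFiltration (connection (weightPoly b)) V) ∧
    ∀ V : ℚ → Submodule tauPoly (System (weightPoly b)),
      IsVFiltration (connection (weightPoly b)) V →
      (∃ S : Pairing (weightPoly b), IsDuality (weightPoly b) V S ∧
        ∀ S' : Pairing (weightPoly b), IsDuality (weightPoly b) V S' ↔
          ∃ c : ℂ, c ≠ 0 ∧ ∀ x y, S' x y = LaurentPolynomial.C c * S x y) ∧
      ∀ S : Pairing (weightPoly b), IsDuality (weightPoly b) V S →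
        (∀ k < μ, ∀ l < μ, S (omega b k) (omega b l) =
          if (k ≤ n ∧ k + l = n) ∨ (n + 1 ≤ k ∧ k + l = μ + n)
          then S (omega b 0) (omega b n) else 0) ∧
        S (omega b 0) (omega b n) ≠ 0 ∧
        (∀ k < μ, ∀ l < μ, ∃ c : ℂ,
          S (omega b k) (omega b l) =
            LaurentPolynomial.C c * LaurentPolynomial.T (-(n : ℤ))) ∧
        (∀ x y, S y x = (-1) ^ n * bar (S x y)) ∧
        Function.Bijective S ∧ Function.Bijective S.flip := by
  subst hμ
  have : NeZero (∑ i, w i) := ⟨(sum_pos_of_pos hw).ne'⟩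
  refine ⟨⟨_, isVFiltration_omegaBasis b hw hgcd, fun V hV =>
    hV.unique (isVFiltration_omegaBasis b hw hgcd)⟩, fun V hV => ⟨?_, fun S hS => ?_⟩⟩
  · refine ⟨basisPairing n (omegaBasis b hw hgcd), ?_, fun S' => isDuality_iff b hw hgcd hV S'⟩
    exact (isDuality_iff b hw hgcd hV _).2 ⟨1, one_ne_zero, fun x y => by rw [map_one, one_mul]⟩
  · obtain ⟨c, hc, h⟩ := (isDuality_iff b hw hgcd hV S).1 hS
    -- There are n + 1 weights, each at least one.
    have hn' : n < ∑ i, w i := by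
      have : ∑ i : Fin (n + 1), 1 ≤ ∑ i, w i := Finset.sum_le_sum fun i _ => hw i
      simpa using this
    have hω (k l : ℕ) : S (omega b k) (omega b l) =
        if (k : ZMod (∑ i, w i)) + l = n then
          LaurentPolynomial.C c * LaurentPolynomial.T (-(n : ℤ)) else 0 := by
      rw [h, ← omegaBasis_natCast b hw hgcd, ← omegaBasis_natCast b hw hgcd, basisPairing_basis,
        mul_ite, mul_zero]
    have hωn : S (omega b 0) (omega b n) =
        LaurentPolynomial.C c * LaurentPolynomial.T (-(n : ℤ)) := by
      rw [hω, if_pos (by rw [Nat.cast_zero, zero_add])]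
    refine ⟨fun k hk l hl => ?_, ?_, fun k _ l _ => ?_, fun x y => ?_, ?_, ?_⟩
    · rw [hω, hωn]
      simp only [natCast_add_eq_iff hn' hk hl]
    · rw [hωn, ← LaurentPolynomial.single_eq_C_mul_T]
      exact AddMonoidAlgebra.single_ne_zero.2 hc
    · rw [hω]
      split_ifs
      exacts [⟨c, rfl⟩, ⟨0, by rw [map_zero, zero_mul]⟩]
    · rw [h, h, basisPairing_symm, map_mul, bar_C, mul_left_comm]
    · exact bijective_smul_of_bijective hc (bijective_basisPairing (n := n) (omegaBasis b hw hgcd))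
        fun x => LinearMap.ext fun y => h x y
    · exact bijective_smul_of_bijective hc
        (bijective_basisPairing_flip (n := n) (omegaBasis b hw hgcd))
        fun y => LinearMap.ext fun x => by
          rw [LinearMap.smul_apply, LinearMap.flip_apply, LinearMap.flip_apply, smul_eq_mul, h]
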